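/- Let $(M,g)$ be a smooth Riemannian manifold of dimension $3$ and let $\tilde g=e^{2f}g$, with $f\in C^\infty(M)$, be a metric in the conformal class $[g]$. Suppose that $\tilde g$ admits a smooth vector field $X$ that is parallel ($\nabla^{\tilde g}X=0$ for the Levi-Civita connection of $\tilde g$) and does not vanish identically on any connected component of $M$. Then for every $p\in M$ there is a nonzero tangent vector $v\in T_pM$ such that $$CY_p(v,v)=0\qquad\text{and}\qquad CY_p(w_1,w_2)=0\quad\text{for all } w_1,w_2\in v^{\perp}=\{w\in T_pM : g_p(v,w)=0\}.$$ Here $CY$ is the $(0,2)$ Cotton–York tensor of $g$: with the Schouten tensor $S=\mathrm{Ric}-\tfrac14 s\,g$ ($s$ the scalar curvature) and the Cotton tensor $C_{ijk}=(\nabla_iS)_{jk}-(\nabla_jS)_{ik}$, it is given in any local coordinates by $$CY_{ij}=\frac12\sum_{k,l,m}C_{kli}\,g_{jm}\,\frac{\epsilon^{klm}}{\sqrt{\det g}},$$ where $\epsilon^{klm}$ is the sign of the permutation $(k,l,m)$ of $(1,2,3)$, and $0$ if it is not a permutation. This is a tensor up to the sign given by the orientation of the coordinates, which does not affect the statement.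 -/

import Mathlib

open scoped Manifold ContDiff

noncomputable section

namespace ConformalGeom

/-- The model space `ℝⁿ`. -/
abbrev Model (n : ℕ) : Type := EuclideanSpace ℝ (Fin n)

/-! ### Riemannian geometry of a matrix-valued function on `ℝⁿ`

Here `G : ℝⁿ → Mat_n(ℝ)` is the matrix of a metric `g` in local coordinates. -/

section Local

variable {n : ℕ}

/-- The partial derivative `∂ᵢ f`. -/
def pd (i : Fin n) (f : Model n → ℝ) (x : Model n) : ℝ :=
  fderiv ℝ f x (EuclideanSpace.single i 1)

/-- Christoffel symbols: `christoffel G k i j = Γᵏᵢⱼ`. -/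
def christoffel (G : Model n → Matrix (Fin n) (Fin n) ℝ) (k i j : Fin n) (x : Model n) : ℝ :=
  (1 / 2) * ∑ l, (G x)⁻¹ k l *
    (pd i (fun y => G y j l) x + pd j (fun y => G y i l) x - pd l (fun y => G y i j) x)

/-- The `(1,3)` curvature tensor: `R(∂ᵢ, ∂ⱼ)∂ₖ = ∑ₗ (riemann G l i j k) ∂ₗ`, where
`R(X, Y)Z = ∇_X ∇_Y Z - ∇_Y ∇_X Z - ∇_[X,Y] Z`. -/
def riemann (G : Model n → Matrix (Fin n) (Fin n) ℝ) (l i j k : Fin n) (x : Model n) : ℝ :=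
  pd i (christoffel G l j k) x - pd j (christoffel G l i k) x
    + ∑ m, (christoffel G l i m x * christoffel G m j k x
      - christoffel G l j m x * christoffel G m i k x)

/-- The Ricci tensor: `Ric(Y, Z)` is the trace of `X ↦ R(X, Y)Z`. -/
def ricci (G : Model n → Matrix (Fin n) (Fin n) ℝ) (j k : Fin n) (x : Model n) : ℝ :=
  ∑ i, riemann G i i j k x

/-- The scalar curvature `s = gʲᵏ Ricⱼₖ`. -/
def scalarCurv (G : Model n → Matrix (Fin n) (Fin n) ℝ) (x : Model n) : ℝ :=
  ∑ j, ∑ k, (G x)⁻¹ j k * ricci G j k x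

/-- The Schouten tensor `S = (Ric - s g / (2 (n - 1))) / (n - 2)` (meaningful for `n ≥ 3`). -/
def schouten (G : Model n → Matrix (Fin n) (Fin n) ℝ) (j k : Fin n) (x : Model n) : ℝ :=
  (1 / ((n : ℝ) - 2)) *
    (ricci G j k x - (1 / (2 * ((n : ℝ) - 1))) * scalarCurv G x * G x j k)

/-- `(∇ₐ S)_{bc}`, the covariant derivative of the Schouten tensor. -/
def nablaSchouten (G : Model n → Matrix (Fin n) (Fin n) ℝ) (a b c : Fin n) (x : Model n) : ℝ :=
  pd a (schouten G b c) x - ∑ m, christoffel G m a b x * schouten G m c x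
    - ∑ m, christoffel G m a c x * schouten G b m x

/-- The Cotton tensor `C_{ijk} = (∇ᵢ S)_{jk} - (∇ⱼ S)_{ik}`. -/
def cotton (G : Model n → Matrix (Fin n) (Fin n) ℝ) (i j k : Fin n) (x : Model n) : ℝ :=
  nablaSchouten G i j k x - nablaSchouten G j i k x

/-- The `(0,2)` Cotton–York tensor in dimension three,
`CY_{ij} = (1/2) C_{kli} g_{jm} ε^{klm} / √(det g)`. Only those `(k, l, m)` that form a permutation
of the three indices contribute, so the sum is taken over permutations. -/
def cottonYorkCoeff (G : Model 3 → Matrix (Fin 3) (Fin 3) ℝ) (i j : Fin 3) (x : Model 3) : ℝ :=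
  (1 / 2) * ∑ σ : Equiv.Perm (Fin 3),
    cotton G (σ 0) (σ 1) i x * G x j (σ 2) * ((Equiv.Perm.sign σ : ℤ) : ℝ) / √(G x).det

end Local

/-! ### Riemannian metrics on manifolds, read in charts -/

section Global

variable {n : ℕ} {M : Type*} [TopologicalSpace M] [ChartedSpace (Model n) M]

/-- The coordinate vector field `∂ᵢ` of the chart `e`, at the point with coordinates `x`. -/
def coordVec (e : OpenPartialHomeomorph M (Model n)) (x : Model n) (i : Fin n) :
    TangentSpace 𝓘(ℝ, Model n) (e.symm x) :=
  mfderiv 𝓘(ℝ, Model n) 𝓘(ℝ, Model n) e.symm x (EuclideanSpace.single i (1 : ℝ) : Model n)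

/-- The components `vⁱ = dxⁱ(v)` of a tangent vector in the chart `e`. -/
def coordOf (e : OpenPartialHomeomorph M (Model n)) (p : M) (v : TangentSpace 𝓘(ℝ, Model n) p) :
    Model n :=
  mfderiv 𝓘(ℝ, Model n) 𝓘(ℝ, Model n) e p v

variable [IsManifold 𝓘(ℝ, Model n) ∞ M]

variable (n M) in
/-- A smooth Riemannian metric on the tangent bundle of `M`. -/
abbrev SmoothMetric : Type _ :=
  Bundle.ContMDiffRiemannianMetric 𝓘(ℝ, Model n) ∞ (Model n)
    (fun p : M => TangentSpace 𝓘(ℝ, Model n) p)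

/-- The matrix `gᵢⱼ = g(∂ᵢ, ∂ⱼ)` of the metric in the chart `e`, as a function of the
coordinates. -/
def metricMatrix (g : SmoothMetric n M) (e : OpenPartialHomeomorph M (Model n)) (x : Model n) :
    Matrix (Fin n) (Fin n) ℝ :=
  Matrix.of fun i j => g.inner (e.symm x) (coordVec e x i) (coordVec e x j)

/-- `g' ∈ [g]`: there is a smooth function `f` with `g' = e^{2f} g`. -/
def IsConformal (g g' : SmoothMetric n M) : Prop :=
  ∃ f : M → ℝ, ContMDiff 𝓘(ℝ, Model n) 𝓘(ℝ, ℝ) ∞ f ∧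
    ∀ (p : M) (v w : TangentSpace 𝓘(ℝ, Model n) p),
      g'.inner p v w = Real.exp (2 * f p) * g.inner p v w

/-- `X` is a smooth vector field with `∇X = 0` for the Levi-Civita connection of `g`: in every
smooth chart, `∂ᵢ Xᵏ + Γᵏᵢⱼ Xʲ = 0`. -/
def IsParallel (g : SmoothMetric n M) (X : ∀ p : M, TangentSpace 𝓘(ℝ, Model n) p) : Prop :=
  ContMDiff 𝓘(ℝ, Model n) 𝓘(ℝ, Model n).tangent ∞
    (fun p => (⟨p, X p⟩ : TangentBundle 𝓘(ℝ, Model n) M)) ∧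
  ∀ e ∈ IsManifold.maximalAtlas 𝓘(ℝ, Model n) ∞ M, ∀ x ∈ e.target, ∀ i k : Fin n,
    pd i (fun y => coordOf e (e.symm y) (X (e.symm y)) k) x
      + ∑ j, christoffel (metricMatrix g e) k i j x * coordOf e (e.symm x) (X (e.symm x)) j = 0

end Global

/-- `CY_p(v, w)` for the metric `g` on a 3-manifold, computed in the chart `e` around `p` and with
respect to the orientation given by `e`; charts of opposite orientation give the opposite sign. -/
def cottonYork {M : Type*} [TopologicalSpace M] [ChartedSpace (Model 3) M]
    [IsManifold 𝓘(ℝ, Model 3) ∞ M] (g : SmoothMetric 3 M) (e : OpenPartialHomeomorph M (Model 3))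
    (p : M) (v w : TangentSpace 𝓘(ℝ, Model 3) p) : ℝ :=
  ∑ i, ∑ j, cottonYorkCoeff (metricMatrix g e) i j (e p) * coordOf e p v i * coordOf e p w j

end ConformalGeom

end

/-!
Let `h = g'`, let `ξ = h X` be the covector dual to the parallel field and `c = |X|²`, a positive
constant. The curvature of `h` annihilates `X`. In dimension three the curvature-like tensors that
annihilate `X` form a line, so the curvature is a function `K` times that of the Schouten tensor
`P = h / 2 - ξ ⊗ ξ / c`, the one of a line times a surface of curvature one. Thus the Schouten
tensor of `h` is `K P`. Since `P` is parallel, the second Bianchi identity gives `dK(X) = 0`, and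
the Cotton tensor of `h` is `dK ∧ P`. In dimension three the Cotton tensor is conformally
invariant, so this is also the Cotton tensor of `g`, and contracting it yields
`CY(a, b) = det(dK, P a, g b) / √(det g)`. For `a = b = X` the last two rows are proportional; for
`a` and `b` orthogonal to `X` all three rows annihilate `X`.

These tensor identities use only the laws of derivations, so they hold over any commutative ring
with a frame of commuting derivations, such as the smooth functions on the image of a chart.
-/

open scoped Manifold ContDiff

noncomputable section

namespace ConformalGeom

open Matrix

section Derivations

variable {R A ι : Type*} [CommRing R] [CommRing A] [Algebra R A] (d : Derivation R A A)

/-- The entrywise action of a derivation on vectors. -/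
def vecDeriv : (ι → A) →ₗ[R] ι → A := (d : A →ₗ[R] A).compLeft ι

/-- The entrywise action of a derivation on square matrices. -/
def matDeriv : Matrix ι ι A →ₗ[R] Matrix ι ι A := (d : A →ₗ[R] A).mapMatrix

lemma vecDeriv_apply (v : ι → A) (i : ι) : vecDeriv d v i = d (v i) := rfl

lemma matDeriv_apply (M : Matrix ι ι A) (i j : ι) : matDeriv d M i j = d (M i j) := rfl

lemma matDeriv_transpose (M : Matrix ι ι A) : matDeriv d Mᵀ = (matDeriv d M)ᵀ := rfl

lemma vecDeriv_smul (a : A) (v : ι → A) : vecDeriv d (a • v) = d a • v + a • vecDeriv d v := by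
  ext i
  simp only [vecDeriv_apply, Pi.add_apply, Pi.smul_apply, smul_eq_mul, Derivation.leibniz]
  ring

lemma matDeriv_smul (a : A) (M : Matrix ι ι A) :
    matDeriv d (a • M) = d a • M + a • matDeriv d M := by
  ext i j
  simp only [matDeriv_apply, Matrix.add_apply, Matrix.smul_apply, smul_eq_mul, Derivation.leibniz]
  ring

lemma matDeriv_vecMulVec (v w : ι → A) :
    matDeriv d (vecMulVec v w) = vecMulVec (vecDeriv d v) w + vecMulVec v (vecDeriv d w) := by
  ext i j
  simp only [matDeriv_apply, vecDeriv_apply, vecMulVec_apply, Matrix.add_apply, smul_eq_mul,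
    Derivation.leibniz]
  ring

lemma derivation_invOf_two [Invertible (2 : A)] : d ⅟2 = 0 := by
  rw [Derivation.leibniz_invOf, show d 2 = 0 from mod_cast d.map_natCast 2, smul_zero]

section Finite

variable [Fintype ι]

lemma derivation_dotProduct (v w : ι → A) :
    d (v ⬝ᵥ w) = vecDeriv d v ⬝ᵥ w + v ⬝ᵥ vecDeriv d w := by
  simp only [dotProduct, vecDeriv_apply, map_sum, Derivation.leibniz, smul_eq_mul,
    ← Finset.sum_add_distrib]
  exact Finset.sum_congr rfl fun k _ => by ring

lemma matDeriv_mul (M N : Matrix ι ι A) :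
    matDeriv d (M * N) = matDeriv d M * N + M * matDeriv d N := by
  ext i j
  exact derivation_dotProduct d (M i) (Nᵀ j)

lemma vecDeriv_mulVec (M : Matrix ι ι A) (v : ι → A) :
    vecDeriv d (M *ᵥ v) = matDeriv d M *ᵥ v + M *ᵥ vecDeriv d v := by
  ext i
  exact derivation_dotProduct d (M i) v

lemma vecDeriv_vecMul (v : ι → A) (M : Matrix ι ι A) :
    vecDeriv d (v ᵥ* M) = vecDeriv d v ᵥ* M + v ᵥ* matDeriv d M := by
  ext i
  exact derivation_dotProduct d v (Mᵀ i)

end Finite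

section DecidableEq

variable [DecidableEq ι]

lemma vecDeriv_single_one (i : ι) : vecDeriv d (Pi.single i (1 : A)) = 0 := by
  ext k
  rw [vecDeriv_apply, Pi.zero_apply, Pi.single_apply, apply_ite d,
    Derivation.map_one_eq_zero, map_zero, ite_self]

lemma matDeriv_one : matDeriv d (1 : Matrix ι ι A) = 0 := by
  ext i j
  rw [matDeriv_apply, one_apply, apply_ite d, Derivation.map_one_eq_zero, map_zero, ite_self]
  rfl

end DecidableEq

end Derivations

section Connections

variable {R A ι : Type*} [CommRing R] [CommRing A] [Algebra R A]

/-- The differential of a function with respect to the frame of derivations `D`. -/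
def differential (D : ι → Derivation R A A) (φ : A) : ι → A := fun i => D i φ

lemma differential_apply (D : ι → Derivation R A A) (φ : A) (i : ι) :
    differential D φ i = D i φ := rfl

/-- The frame `D` consists of commuting derivations, as coordinate vector fields do. -/
def IsHolonomic (D : ι → Derivation R A A) : Prop := ∀ i j a, D i (D j a) = D j (D i a)

/-- The connection with matrices `(Γ i) k j = Γᵏᵢⱼ` is torsion-free in a holonomic frame. -/
def IsTorsionFree (Γ : ι → Matrix ι ι A) : Prop := ∀ i j, (Γ i).col j = (Γ j).col i

variable {D : ι → Derivation R A A} {Γ : ι → Matrix ι ι A}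

lemma IsHolonomic.vecDeriv_comm (hD : IsHolonomic D) (i j : ι) (v : ι → A) :
    vecDeriv (D i) (vecDeriv (D j) v) = vecDeriv (D j) (vecDeriv (D i) v) :=
  funext fun k => hD i j (v k)

lemma IsHolonomic.matDeriv_comm (hD : IsHolonomic D) (i j : ι) (M : Matrix ι ι A) :
    matDeriv (D i) (matDeriv (D j) M) = matDeriv (D j) (matDeriv (D i) M) :=
  Matrix.ext fun k l => hD i j (M k l)

variable [Fintype ι]

variable (D Γ) in
/-- The curvature `R_{ij} = ∂ᵢΓⱼ - ∂ⱼΓᵢ + [Γᵢ, Γⱼ]` of a connection, as an endomorphism. -/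
def curvature (i j : ι) : Matrix ι ι A :=
  matDeriv (D i) (Γ j) - matDeriv (D j) (Γ i) + ⁅Γ i, Γ j⁆

variable (D Γ) in
/-- The covariant derivative of an endomorphism field. -/
def covDeriv (i : ι) (M : Matrix ι ι A) : Matrix ι ι A := matDeriv (D i) M + ⁅Γ i, M⁆

variable (D Γ) in
/-- The bilinear form `Q` is parallel. For a nondegenerate symmetric `Q` this says that the
connection is metric. -/
def IsParallelForm (Q : Matrix ι ι A) : Prop :=
  ∀ i, matDeriv (D i) Q = Q * Γ i + (Γ i)ᵀ * Q

variable (D Γ) in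
/-- The exterior covariant derivative `(∇ᵢQ)ⱼ - (∇ⱼQ)ᵢ` of a bilinear form `Q`, regarded as a
covector-valued one-form with values the rows `Q j`. The terms `Γᵏᵢⱼ Qₖ` cancel in the
torsion-free case. -/
def extCovDeriv (Q : Matrix ι ι A) (i j : ι) : ι → A :=
  vecDeriv (D i) (Q j) - Q j ᵥ* Γ i - (vecDeriv (D j) (Q i) - Q i ᵥ* Γ j)

variable (D Γ) in
/-- The second covariant derivative of a function. -/
def hessian (φ : A) : Matrix ι ι A :=
  of fun i => vecDeriv (D i) (differential D φ) - differential D φ ᵥ* Γ i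

lemma hessian_apply (φ : A) (i : ι) :
    hessian D Γ φ i = vecDeriv (D i) (differential D φ) - differential D φ ᵥ* Γ i := rfl

lemma curvature_add (Θ : ι → Matrix ι ι A) (i j : ι) :
    curvature D (Γ + Θ) i j
      = curvature D Γ i j + (covDeriv D Γ i (Θ j) - covDeriv D Γ j (Θ i)) + ⁅Θ i, Θ j⁆ := by
  simp only [curvature, covDeriv, Ring.lie_def, Pi.add_apply, map_add]
  noncomm_ring

lemma curvature_swap (i j : ι) : curvature D Γ i j = -curvature D Γ j i := by
  simp only [curvature, Ring.lie_def]
  abel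

lemma curvature_bianchi_first (hΓ : IsTorsionFree Γ) (i j k l : ι) :
    curvature D Γ i j l k + curvature D Γ j k l i + curvature D Γ k i l j = 0 := by
  have hsymm : ∀ a b, Γ a l b = Γ b l a := fun a b => congrFun (hΓ a b) l
  have hmul : ∀ a b c, (Γ a * Γ b) l c = (Γ a * Γ c) l b := fun a b c =>
    congrArg (Γ a l ⬝ᵥ ·) (hΓ b c)
  simp only [curvature, Ring.lie_def, matDeriv_apply, Matrix.add_apply, Matrix.sub_apply]
  rw [hsymm j k, hsymm i k, hsymm i j, hmul i j k, hmul j k i, hmul k i j]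
  ring

lemma curvature_bianchi_second (hD : IsHolonomic D) (a i j : ι) :
    covDeriv D Γ a (curvature D Γ i j) + covDeriv D Γ i (curvature D Γ j a)
      + covDeriv D Γ j (curvature D Γ a i) = 0 := by
  simp only [covDeriv, curvature, Ring.lie_def, map_add, map_sub, matDeriv_mul]
  rw [hD.matDeriv_comm a i, hD.matDeriv_comm a j, hD.matDeriv_comm i j]
  noncomm_ring

lemma covDeriv_add (i : ι) (M N : Matrix ι ι A) :
    covDeriv D Γ i (M + N) = covDeriv D Γ i M + covDeriv D Γ i N := by
  simp only [covDeriv, Ring.lie_def, map_add]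
  noncomm_ring

lemma covDeriv_sub (i : ι) (M N : Matrix ι ι A) :
    covDeriv D Γ i (M - N) = covDeriv D Γ i M - covDeriv D Γ i N := by
  simp only [covDeriv, Ring.lie_def, map_sub]
  noncomm_ring

lemma covDeriv_smul (i : ι) (a : A) (M : Matrix ι ι A) :
    covDeriv D Γ i (a • M) = D i a • M + a • covDeriv D Γ i M := by
  simp only [covDeriv, Ring.lie_def, matDeriv_smul, Matrix.mul_smul, Matrix.smul_mul]
  module

lemma covDeriv_vecMulVec (i : ι) (v α : ι → A) :
    covDeriv D Γ i (vecMulVec v α) = vecMulVec (vecDeriv (D i) v + Γ i *ᵥ v) α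
      + vecMulVec v (vecDeriv (D i) α - α ᵥ* Γ i) := by
  simp only [covDeriv, Ring.lie_def, matDeriv_vecMulVec, mul_vecMulVec, vecMulVec_mul,
    add_vecMulVec, vecMulVec_sub]
  abel

lemma curvature_mulVec_eq_zero (hD : IsHolonomic D) {X : ι → A}
    (hX : ∀ i, vecDeriv (D i) X = -(Γ i *ᵥ X)) (i j : ι) : curvature D Γ i j *ᵥ X = 0 := by
  have hcomm := hD.vecDeriv_comm i j X
  simp only [hX, map_neg, vecDeriv_mulVec, mulVec_neg, mulVec_mulVec] at hcomm
  simp only [curvature, Ring.lie_def, add_mulVec, sub_mulVec]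
  linear_combination -hcomm

lemma IsParallelForm.mul_curvature {Q : Matrix ι ι A} (hD : IsHolonomic D)
    (hQ : IsParallelForm D Γ Q) (i j : ι) :
    Q * curvature D Γ i j + (curvature D Γ i j)ᵀ * Q = 0 := by
  have hcomm := hD.matDeriv_comm i j Q
  simp only [hQ _, map_add, matDeriv_mul, matDeriv_transpose] at hcomm
  rw [← sub_eq_zero] at hcomm
  rw [← hcomm]
  simp only [curvature, Ring.lie_def, transpose_add, transpose_sub, transpose_mul]
  noncomm_ring

lemma IsParallelForm.vecDeriv_row {Q : Matrix ι ι A} (hQ : IsParallelForm D Γ Q) (i j : ι) :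
    vecDeriv (D i) (Q j) = Q j ᵥ* Γ i + (Γ i).col j ᵥ* Q :=
  congrFun (hQ i) j

lemma extCovDeriv_sub (P Q : Matrix ι ι A) (i j : ι) :
    extCovDeriv D Γ (P - Q) i j = extCovDeriv D Γ P i j - extCovDeriv D Γ Q i j := by
  have hsub : ∀ k, (P - Q) k = P k - Q k := fun _ => rfl
  simp only [extCovDeriv, hsub, map_sub, sub_vecMul]
  abel

lemma extCovDeriv_smul_of_isParallelForm {Q : Matrix ι ι A} (hΓ : IsTorsionFree Γ)
    (hQ : IsParallelForm D Γ Q) (a : A) (i j : ι) :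
    extCovDeriv D Γ (a • Q) i j = D i a • Q j - D j a • Q i := by
  have hsmul : ∀ k, (a • Q) k = a • Q k := fun _ => rfl
  simp only [extCovDeriv, hsmul, vecDeriv_smul, smul_vecMul, hQ.vecDeriv_row, hΓ j i]
  module

lemma extCovDeriv_hessian (hD : IsHolonomic D) (φ : A) (i j : ι) :
    extCovDeriv D Γ (hessian D Γ φ) i j = -(differential D φ ᵥ* curvature D Γ i j) := by
  simp only [extCovDeriv, hessian_apply, curvature, Ring.lie_def, map_sub, vecDeriv_vecMul,
    sub_vecMul, vecMul_add, vecMul_sub, vecMul_vecMul, hD.vecDeriv_comm j i]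
  abel

lemma hessian_isSymm (hD : IsHolonomic D) (hΓ : IsTorsionFree Γ) (φ : A) :
    (hessian D Γ φ).IsSymm := by
  refine IsSymm.ext fun i j => ?_
  have hcol : (differential D φ ᵥ* Γ i) j = (differential D φ ᵥ* Γ j) i :=
    congrArg (differential D φ ⬝ᵥ ·) (hΓ i j)
  simp only [hessian_apply, Pi.sub_apply, hcol]
  exact congrArg (· - _) (hD j i φ)

end Connections

section CurvatureTensors

variable {R A ι : Type*} [CommRing R] [CommRing A] [Algebra R A]

/-- The algebraic symmetries of a Riemannian curvature tensor with all indices lowered, where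
`Ω i j l k = g(R(∂ᵢ, ∂ⱼ)∂ₖ, ∂ₗ)`. -/
structure IsCurvatureTensor (Ω : ι → ι → Matrix ι ι A) : Prop where
  swap : ∀ i j, Ω i j = -Ω j i
  skew : ∀ i j, (Ω i j)ᵀ = -Ω i j
  bianchi : ∀ i j k l, Ω i j l k + Ω j k l i + Ω k i l j = 0

lemma IsCurvatureTensor.pair_symm [Invertible (2 : A)] {Ω : ι → ι → Matrix ι ι A}
    (hΩ : IsCurvatureTensor Ω) (i j k l : ι) : Ω i j k l = Ω k l i j := by
  have swap : ∀ i j k l, Ω i j k l = -Ω j i k l := fun i j k l =>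
    congrFun (congrFun (hΩ.swap i j) k) l
  have skew : ∀ i j k l, Ω i j l k = -Ω i j k l := fun i j k l =>
    congrFun (congrFun (hΩ.skew i j) k) l
  refine (isUnit_of_invertible (2 : A)).mul_left_cancel ?_
  linear_combination hΩ.bianchi i j l k - hΩ.bianchi i j k l + hΩ.bianchi j l k i
    - hΩ.bianchi l k i j + skew i j k l + skew j k i l + swap k i l j - skew j l k i - skew l k j i
    - swap k j i l + swap k i j l - skew i k l j + swap i l j k - skew l i k j
    + 2 * swap l k j i - 2 * skew k l i j

lemma isCurvatureTensor_mul_curvature [Fintype ι] {D : ι → Derivation R A A}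
    {Γ : ι → Matrix ι ι A} {h : Matrix ι ι A} (hs : h.IsSymm) (hD : IsHolonomic D)
    (hΓ : IsTorsionFree Γ) (hh : IsParallelForm D Γ h) :
    IsCurvatureTensor fun i j => h * curvature D Γ i j where
  swap i j := by rw [curvature_swap, Matrix.mul_neg]
  skew i j := by
    rw [transpose_mul, hs.eq]
    exact eq_neg_of_add_eq_zero_right (hh.mul_curvature hD i j)
  bianchi i j k l := by
    simp only [Matrix.mul_apply, ← Finset.sum_add_distrib, ← mul_add, curvature_bianchi_first hΓ,
      mul_zero, Finset.sum_const_zero]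

end CurvatureTensors

section KulkarniNomizu

variable {A ι : Type*} [CommRing A] [Fintype ι] [DecidableEq ι] {h : Matrix ι ι A}

/-- The Kulkarni–Nomizu product of the metric `h` with the bilinear form `Q`, with one index raised:
the curvature endomorphism of a conformally flat metric `h` with Schouten tensor `Q`. -/
def kulkarniNomizu (h Q : Matrix ι ι A) (i j : ι) : Matrix ι ι A :=
  vecMulVec (Pi.single i 1) (Q j) - vecMulVec (Pi.single j 1) (Q i)
    + vecMulVec (h⁻¹ *ᵥ Q i) (h j) - vecMulVec (h⁻¹ *ᵥ Q j) (h i)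

/-- The Ricci contraction of a curvature endomorphism. -/
def ricciContraction (Ω : ι → ι → Matrix ι ι A) : Matrix ι ι A :=
  of fun j k => ∑ i, Ω i j i k

/-- The trace of the bilinear form `Q` with respect to the metric `h`. -/
def metricTrace (h Q : Matrix ι ι A) : A := ∑ i, (h⁻¹ *ᵥ Q i) i

lemma inv_mulVec_row (hs : h.IsSymm) (hu : IsUnit h.det) (i : ι) :
    h⁻¹ *ᵥ h i = Pi.single i 1 := by
  have hrow : h i = h *ᵥ Pi.single i 1 := by
    rw [mulVec_single_one]
    exact (congrFun hs.eq i).symm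
  rw [hrow, mulVec_mulVec, nonsing_inv_mul _ hu, one_mulVec]

lemma row_dotProduct_inv_mulVec (hu : IsUnit h.det) (i : ι) (v : ι → A) :
    h i ⬝ᵥ h⁻¹ *ᵥ v = v i :=
  congrFun (show h *ᵥ h⁻¹ *ᵥ v = v by rw [mulVec_mulVec, mul_nonsing_inv _ hu, one_mulVec]) i

lemma dotProduct_inv_mulVec_comm (hs : h.IsSymm) (v w : ι → A) :
    v ⬝ᵥ h⁻¹ *ᵥ w = w ⬝ᵥ h⁻¹ *ᵥ v := by
  rw [dotProduct_mulVec, ← mulVec_transpose, transpose_nonsing_inv, hs.eq, dotProduct_comm]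

lemma mul_kulkarniNomizu (hs : h.IsSymm) (hu : IsUnit h.det) (Q : Matrix ι ι A) (i j : ι) :
    h * kulkarniNomizu h Q i j = vecMulVec (h i) (Q j) - vecMulVec (h j) (Q i)
      + vecMulVec (Q i) (h j) - vecMulVec (Q j) (h i) := by
  have hcol : ∀ k, h.col k = h k := fun k => congrFun hs.eq k
  simp only [kulkarniNomizu, Matrix.mul_add, Matrix.mul_sub, mul_vecMulVec, mulVec_single_one,
    mulVec_mulVec, mul_nonsing_inv _ hu, one_mulVec, hcol]

lemma isCurvatureTensor_mul_kulkarniNomizu (hs : h.IsSymm) (hu : IsUnit h.det)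
    {Q : Matrix ι ι A} (hQ : Q.IsSymm) :
    IsCurvatureTensor fun i j => h * kulkarniNomizu h Q i j where
  swap i j := by
    simp only [mul_kulkarniNomizu hs hu]
    abel
  skew i j := by
    simp only [mul_kulkarniNomizu hs hu, transpose_add, transpose_sub, transpose_vecMulVec]
    abel
  bianchi i j k l := by
    simp only [mul_kulkarniNomizu hs hu, Matrix.add_apply, Matrix.sub_apply, vecMulVec_apply]
    rw [hs.apply i j, hs.apply j k, hs.apply i k, hQ.apply i j, hQ.apply j k, hQ.apply i k]
    ring

lemma kulkarniNomizu_sub (P Q : Matrix ι ι A) (i j : ι) :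
    kulkarniNomizu h (P - Q) i j = kulkarniNomizu h P i j - kulkarniNomizu h Q i j := by
  have hsub : ∀ k, (P - Q) k = P k - Q k := fun _ => rfl
  simp only [kulkarniNomizu, hsub, mulVec_sub, vecMulVec_sub, sub_vecMulVec]
  abel

lemma kulkarniNomizu_smul (a : A) (Q : Matrix ι ι A) (i j : ι) :
    kulkarniNomizu h (a • Q) i j = a • kulkarniNomizu h Q i j := by
  have hsmul : ∀ k, (a • Q) k = a • Q k := fun _ => rfl
  simp only [kulkarniNomizu, hsmul, mulVec_smul, vecMulVec_smul, smul_vecMulVec, smul_add,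
    smul_sub]

lemma inv_smul_of_isUnit (hu : IsUnit h.det) {w : A} (hw : IsUnit w) :
    (w • h)⁻¹ = Ring.inverse w • h⁻¹ := by
  obtain ⟨w, rfl⟩ := hw
  rw [Ring.inverse_unit]
  exact Matrix.inv_smul' h w hu

lemma kulkarniNomizu_smul_left (hu : IsUnit h.det) {w : A} (hw : IsUnit w) (Q : Matrix ι ι A)
    (i j : ι) : kulkarniNomizu (w • h) Q i j = kulkarniNomizu h Q i j := by
  have hsmul : ∀ k, (w • h) k = w • h k := fun _ => rfl
  simp only [kulkarniNomizu, inv_smul_of_isUnit hu hw, hsmul, smul_mulVec, smul_vecMulVec,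
    vecMulVec_smul, smul_smul, Ring.mul_inverse_cancel w hw, one_smul]

lemma ricciContraction_kulkarniNomizu (hs : h.IsSymm) (hu : IsUnit h.det) (Q : Matrix ι ι A) :
    ricciContraction (kulkarniNomizu h Q)
      = ((Fintype.card ι : A) - 2) • Q + metricTrace h Q • h := by
  ext j k
  have hraise : ∑ i, (h⁻¹ *ᵥ Q j) i * h i k = Q j k := by
    rw [← row_dotProduct_inv_mulVec hu k (Q j), dotProduct_comm]
    exact Finset.sum_congr rfl fun i _ => by rw [hs.apply k i]
  simp only [ricciContraction, kulkarniNomizu, of_apply, Matrix.add_apply, Matrix.sub_apply,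
    Matrix.smul_apply, vecMulVec_apply, smul_eq_mul, Finset.sum_add_distrib,
    Finset.sum_sub_distrib, hraise, ← Finset.sum_mul, metricTrace, Pi.single_eq_same,
    Pi.single_apply, ite_mul, zero_mul, one_mul, Finset.sum_ite_eq', Finset.mem_univ, if_true,
    Finset.sum_const, Finset.card_univ, nsmul_eq_mul]
  ring

omit [DecidableEq ι] in
lemma ricciContraction_smul (a : A) (Ω : ι → ι → Matrix ι ι A) :
    ricciContraction (fun i j => a • Ω i j) = a • ricciContraction Ω := by
  ext j k
  simp only [ricciContraction, of_apply, Matrix.smul_apply, Finset.smul_sum]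

lemma metricTrace_self (hs : h.IsSymm) (hu : IsUnit h.det) :
    metricTrace h h = Fintype.card ι := by
  simp only [metricTrace, inv_mulVec_row hs hu, Pi.single_eq_same, Finset.sum_const,
    Finset.card_univ, nsmul_eq_mul, mul_one]

lemma metricTrace_add (P Q : Matrix ι ι A) :
    metricTrace h (P + Q) = metricTrace h P + metricTrace h Q := by
  have hadd : ∀ k, (P + Q) k = P k + Q k := fun _ => rfl
  simp only [metricTrace, hadd, mulVec_add, Pi.add_apply, Finset.sum_add_distrib]

lemma metricTrace_smul (a : A) (Q : Matrix ι ι A) :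
    metricTrace h (a • Q) = a * metricTrace h Q := by
  have hsmul : ∀ k, (a • Q) k = a • Q k := fun _ => rfl
  simp only [metricTrace, hsmul, mulVec_smul, Pi.smul_apply, smul_eq_mul, Finset.mul_sum]

lemma metricTrace_ricciContraction_kulkarniNomizu (hs : h.IsSymm) (hu : IsUnit h.det)
    (Q : Matrix ι ι A) :
    metricTrace h (ricciContraction (kulkarniNomizu h Q))
      = 2 * (Fintype.card ι - 1) * metricTrace h Q := by
  rw [ricciContraction_kulkarniNomizu hs hu, metricTrace_add, metricTrace_smul, metricTrace_smul,
    metricTrace_self hs hu]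
  ring

end KulkarniNomizu

section LeviCivita

variable {R A ι : Type*} [CommRing R] [CommRing A] [Algebra R A] [Invertible (2 : A)] [Fintype ι]
  [DecidableEq ι] {D : ι → Derivation R A A} {h : Matrix ι ι A}

/-- The Levi-Civita connection of the metric `h`, given by its Christoffel symbols. -/
def leviCivita (D : ι → Derivation R A A) (h : Matrix ι ι A) (i : ι) : Matrix ι ι A :=
  ⅟(2 : A) • (h⁻¹ * of fun l j => D i (h j l) + D j (h i l) - D l (h i j))

lemma leviCivita_isTorsionFree (hs : h.IsSymm) : IsTorsionFree (leviCivita D h) := by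
  intro i j
  have hcol : ∀ l, D i (h j l) + D j (h i l) - D l (h i j)
      = D j (h i l) + D i (h j l) - D l (h j i) := fun l => by
    rw [hs.apply i j]
    ring
  ext k
  simp only [col_apply, leviCivita, Matrix.smul_apply, Matrix.mul_apply, of_apply, hcol]

lemma leviCivita_isParallelForm (hs : h.IsSymm) (hu : IsUnit h.det) :
    IsParallelForm D (leviCivita D h) h := by
  intro i
  have hlower : h * leviCivita D h i
      = ⅟(2 : A) • of fun l j => D i (h j l) + D j (h i l) - D l (h i j) := by
    rw [leviCivita, Matrix.mul_smul, ← Matrix.mul_assoc, mul_nonsing_inv _ hu, Matrix.one_mul]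
  have htranspose : (leviCivita D h i)ᵀ * h = (h * leviCivita D h i)ᵀ := by
    rw [transpose_mul, hs.eq]
  ext l j
  rw [htranspose, hlower]
  simp only [matDeriv_apply, Matrix.add_apply, Matrix.smul_apply, transpose_apply, of_apply,
    smul_eq_mul]
  rw [hs.apply l j]
  linear_combination (-D i (h l j)) * invOf_mul_self (2 : A)

end LeviCivita

section ConformalChange

variable {R A ι : Type*} [CommRing R] [CommRing A] [Algebra R A] [Fintype ι] [DecidableEq ι]
  {D : ι → Derivation R A A} {Γ : ι → Matrix ι ι A} {h : Matrix ι ι A}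

variable (D h) in
/-- The difference of the Levi-Civita connections of the metrics `e^{2φ} h` and `h`. -/
def conformalDifference (φ : A) (i : ι) : Matrix ι ι A :=
  D i φ • (1 : Matrix ι ι A) + vecMulVec (Pi.single i 1) (differential D φ)
    - vecMulVec (h⁻¹ *ᵥ differential D φ) (h i)

variable (D h) in
/-- The stress-energy tensor `dφ ⊗ dφ - ½ |dφ|² h` of `φ`. -/
def stressForm [Invertible (2 : A)] (φ : A) : Matrix ι ι A :=
  vecMulVec (differential D φ) (differential D φ)
    - (⅟2 * (differential D φ ⬝ᵥ h⁻¹ *ᵥ differential D φ)) • h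

lemma stressForm_row [Invertible (2 : A)] (φ : A) (i : ι) :
    stressForm D h φ i = D i φ • differential D φ
      - (⅟2 * (differential D φ ⬝ᵥ h⁻¹ *ᵥ differential D φ)) • h i := rfl

variable (D Γ h) in
/-- The tensor `∇dφ - dφ ⊗ dφ + ½ |dφ|² h` by which the Schouten tensors of `h` and `e^{2φ} h`
differ. -/
def conformalSchouten [Invertible (2 : A)] (φ : A) : Matrix ι ι A :=
  hessian D Γ φ - stressForm D h φ

/-- `w` stands for `e^{2φ}`, which need not make sense in `A`. -/
lemma leviCivita_smul [Invertible (2 : A)] (hs : h.IsSymm) (hu : IsUnit h.det) {w φ : A}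
    (hw : IsUnit w) (hφ : ∀ i, D i w = 2 * w * D i φ) (i : ι) :
    leviCivita D (w • h) i = leviCivita D h i + conformalDifference D h φ i := by
  have hsymbols : (of fun l j => D i ((w • h) j l) + D j ((w • h) i l) - D l ((w • h) i j))
      = w • ((of fun l j => D i (h j l) + D j (h i l) - D l (h i j))
        + (2 : A) • (D i φ • h + vecMulVec (h i) (differential D φ)
          - vecMulVec (differential D φ) (h i))) := by
    ext l j
    simp only [of_apply, Matrix.add_apply, Matrix.sub_apply, Matrix.smul_apply, smul_eq_mul,
      vecMulVec_apply, Derivation.leibniz, hφ, differential]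
    rw [hs.apply l j]
    ring
  rw [leviCivita, hsymbols, inv_smul_of_isUnit hu hw, Matrix.smul_mul, Matrix.mul_smul,
    smul_smul (Ring.inverse w), Ring.inverse_mul_cancel w hw, one_smul, Matrix.mul_add, smul_add,
    Matrix.mul_smul, smul_smul, invOf_mul_self, one_smul, leviCivita, conformalDifference,
    Matrix.mul_sub, Matrix.mul_add, Matrix.mul_smul, nonsing_inv_mul _ hu, mul_vecMulVec,
    mul_vecMulVec, inv_mulVec_row hs hu]

lemma covDeriv_smul_one (i : ι) (a : A) :
    covDeriv D Γ i (a • (1 : Matrix ι ι A)) = D i a • (1 : Matrix ι ι A) := by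
  simp only [covDeriv, Ring.lie_def, matDeriv_smul, matDeriv_one, smul_zero, add_zero,
    Matrix.mul_smul, Matrix.smul_mul, Matrix.mul_one, Matrix.one_mul, sub_self]

lemma vecDeriv_single_one_add (i j : ι) :
    vecDeriv (D i) (Pi.single j 1) + Γ i *ᵥ Pi.single j 1 = (Γ i).col j := by
  rw [vecDeriv_single_one, zero_add, mulVec_single_one]

lemma vecDeriv_inv_mulVec_add (hu : IsUnit h.det) (hh : IsParallelForm D Γ h) (i : ι)
    (α : ι → A) :
    vecDeriv (D i) (h⁻¹ *ᵥ α) + Γ i *ᵥ h⁻¹ *ᵥ α = h⁻¹ *ᵥ (vecDeriv (D i) α - α ᵥ* Γ i) := by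
  have hα : h *ᵥ h⁻¹ *ᵥ α = α := by rw [mulVec_mulVec, mul_nonsing_inv _ hu, one_mulVec]
  have hlower : vecDeriv (D i) α
      = h *ᵥ (vecDeriv (D i) (h⁻¹ *ᵥ α) + Γ i *ᵥ h⁻¹ *ᵥ α) + α ᵥ* Γ i := by
    conv_lhs => rw [← hα, vecDeriv_mulVec, hh i, add_mulVec, ← mulVec_mulVec, ← mulVec_mulVec, hα,
      mulVec_transpose]
    rw [mulVec_add]
    abel
  rw [sub_eq_of_eq_add hlower, mulVec_mulVec _ h⁻¹ h, nonsing_inv_mul _ hu, one_mulVec]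

lemma covDeriv_conformalDifference_sub (hu : IsUnit h.det) (hD : IsHolonomic D)
    (hΓ : IsTorsionFree Γ) (hh : IsParallelForm D Γ h) (φ : A) (i j : ι) :
    covDeriv D Γ i (conformalDifference D h φ j) - covDeriv D Γ j (conformalDifference D h φ i)
      = -kulkarniNomizu h (hessian D Γ φ) i j := by
  have hexpand : ∀ i j, covDeriv D Γ i (conformalDifference D h φ j)
      = D i (D j φ) • (1 : Matrix ι ι A) + vecMulVec ((Γ i).col j) (differential D φ)
        + vecMulVec (Pi.single j 1) (hessian D Γ φ i)
        - vecMulVec (h⁻¹ *ᵥ hessian D Γ φ i) (h j)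
        - vecMulVec (h⁻¹ *ᵥ differential D φ) ((Γ i).col j ᵥ* h) := fun i j => by
    rw [conformalDifference, covDeriv_sub, covDeriv_add, covDeriv_smul_one,
      covDeriv_vecMulVec, covDeriv_vecMulVec, vecDeriv_single_one_add,
      vecDeriv_inv_mulVec_add hu hh, hh.vecDeriv_row, add_sub_cancel_left, hessian_apply]
    abel
  rw [hexpand, hexpand, hD i j, hΓ i j, kulkarniNomizu]
  abel

lemma lie_conformalDifference [Invertible (2 : A)] (hs : h.IsSymm) (hu : IsUnit h.det) (φ : A)
    (i j : ι) : ⁅conformalDifference D h φ i, conformalDifference D h φ j⁆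
      = kulkarniNomizu h (stressForm D h φ) i j := by
  have hdiff : ∀ k, h k ⬝ᵥ h⁻¹ *ᵥ differential D φ = D k φ :=
    fun k => row_dotProduct_inv_mulVec hu k _
  have htwo : ∀ (a : A) (M : Matrix ι ι A), a • M = (2 * (⅟2 * a)) • M := fun a M => by
    rw [mul_invOf_cancel_left']
  simp only [Ring.lie_def, conformalDifference, kulkarniNomizu, Matrix.mul_add, Matrix.add_mul,
    Matrix.mul_sub, Matrix.sub_mul, Matrix.mul_smul, Matrix.smul_mul, Matrix.mul_one,
    Matrix.one_mul, vecMulVec_mul_vecMulVec, vecMulVec_smul, dotProduct_single_one,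
    differential_apply, hdiff, htwo (differential D φ ⬝ᵥ _), stressForm_row, mulVec_sub,
    mulVec_smul, inv_mulVec_row hs hu, vecMulVec_sub, sub_vecMulVec, smul_vecMulVec, hs.apply i j]
  module

lemma curvature_add_conformalDifference [Invertible (2 : A)] (hs : h.IsSymm) (hu : IsUnit h.det)
    (hD : IsHolonomic D) (hΓ : IsTorsionFree Γ) (hh : IsParallelForm D Γ h) (φ : A) (i j : ι) :
    curvature D (Γ + conformalDifference D h φ) i j
      = curvature D Γ i j - kulkarniNomizu h (conformalSchouten D Γ h φ) i j := by
  rw [curvature_add, covDeriv_conformalDifference_sub hu hD hΓ hh, lie_conformalDifference hs hu,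
    conformalSchouten, kulkarniNomizu_sub]
  abel

lemma differential_vecMul_kulkarniNomizu (Q : Matrix ι ι A) (φ : A) (i j : ι) :
    differential D φ ᵥ* kulkarniNomizu h Q i j
      = D i φ • Q j - D j φ • Q i + (differential D φ ⬝ᵥ h⁻¹ *ᵥ Q i) • h j
        - (differential D φ ⬝ᵥ h⁻¹ *ᵥ Q j) • h i := by
  simp only [kulkarniNomizu, vecMul_add, vecMul_sub, vecMul_vecMulVec, dotProduct_single_one,
    differential_apply]

lemma extCovDeriv_add_conformalDifference (hs : h.IsSymm) {Q : Matrix ι ι A} (hQ : Q.IsSymm)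
    (φ : A) (i j : ι) :
    extCovDeriv D (Γ + conformalDifference D h φ) Q i j
      = extCovDeriv D Γ Q i j - differential D φ ᵥ* kulkarniNomizu h Q i j := by
  rw [differential_vecMul_kulkarniNomizu]
  simp only [extCovDeriv, conformalDifference, Pi.add_apply, vecMul_add, vecMul_sub, vecMul_smul,
    vecMul_one, vecMul_vecMulVec, dotProduct_single_one, hQ.apply i j,
    dotProduct_inv_mulVec_comm hs (Q _)]
  abel

section Stress

variable [Invertible (2 : A)]

lemma stressForm_isSymm (hs : h.IsSymm) (φ : A) : (stressForm D h φ).IsSymm := by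
  rw [IsSymm, stressForm, transpose_sub, transpose_vecMulVec, transpose_smul, hs.eq]

lemma differential_vecMul_kulkarniNomizu_stressForm (hs : h.IsSymm) (hu : IsUnit h.det) (φ : A)
    (i j : ι) : differential D φ ᵥ* kulkarniNomizu h (stressForm D h φ) i j = 0 := by
  simp only [differential_vecMul_kulkarniNomizu, stressForm_row, mulVec_sub, mulVec_smul,
    dotProduct_sub, dotProduct_smul, inv_mulVec_row hs hu, dotProduct_single_one,
    differential_apply, smul_eq_mul]
  linear_combination (norm := module) invOf_mul_self (2 : A)
    • ((differential D φ ⬝ᵥ h⁻¹ *ᵥ differential D φ) • (D j φ • h i - D i φ • h j))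

lemma derivation_half_normSq_differential (hs : h.IsSymm) (hu : IsUnit h.det)
    (hh : IsParallelForm D Γ h) (φ : A) (i : ι) :
    D i (⅟2 * (differential D φ ⬝ᵥ h⁻¹ *ᵥ differential D φ))
      = differential D φ ⬝ᵥ h⁻¹ *ᵥ hessian D Γ φ i := by
  have hsharp := eq_sub_of_add_eq (vecDeriv_inv_mulVec_add hu hh i (differential D φ))
  have hdiff : vecDeriv (D i) (differential D φ)
      = hessian D Γ φ i + differential D φ ᵥ* Γ i := by rw [hessian_apply, sub_add_cancel]
  rw [← hessian_apply] at hsharp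
  rw [Derivation.leibniz, derivation_invOf_two, smul_zero, add_zero, derivation_dotProduct, hsharp,
    hdiff, add_dotProduct, dotProduct_sub, ← dotProduct_mulVec,
    dotProduct_inv_mulVec_comm hs (hessian D Γ φ i), smul_eq_mul]
  linear_combination (differential D φ ⬝ᵥ h⁻¹ *ᵥ hessian D Γ φ i) * invOf_mul_self (2 : A)

lemma extCovDeriv_stressForm (hs : h.IsSymm) (hu : IsUnit h.det) (hD : IsHolonomic D)
    (hΓ : IsTorsionFree Γ) (hh : IsParallelForm D Γ h) (φ : A) (i j : ι) :
    extCovDeriv D Γ (stressForm D h φ) i j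
      = -(differential D φ ᵥ* kulkarniNomizu h (hessian D Γ φ) i j) := by
  have hdiff : ∀ k, vecDeriv (D k) (differential D φ)
      = hessian D Γ φ k + differential D φ ᵥ* Γ k := fun k => by
    rw [hessian_apply, sub_add_cancel]
  simp only [differential_vecMul_kulkarniNomizu, extCovDeriv, stressForm_row, map_sub,
    vecDeriv_smul, derivation_half_normSq_differential hs hu hh, hh.vecDeriv_row, hdiff, sub_vecMul,
    smul_vecMul, hD j i φ, hΓ j i]
  module

end Stress

/-- The Cotton tensor of a metric with curvature `kulkarniNomizu h P` is `extCovDeriv P`, so this is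
the conformal invariance of the Cotton tensor. -/
lemma extCovDeriv_sub_conformalSchouten [Invertible (2 : A)] (hs : h.IsSymm) (hu : IsUnit h.det)
    (hD : IsHolonomic D) (hΓ : IsTorsionFree Γ) (hh : IsParallelForm D Γ h) {P : Matrix ι ι A}
    (hP : P.IsSymm) (hcurv : ∀ i j, curvature D Γ i j = kulkarniNomizu h P i j) (φ : A)
    (i j : ι) :
    extCovDeriv D (Γ + conformalDifference D h φ) (P - conformalSchouten D Γ h φ) i j
      = extCovDeriv D Γ P i j := by
  have hsymm : (P - conformalSchouten D Γ h φ).IsSymm :=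
    hP.sub ((hessian_isSymm hD hΓ φ).sub (stressForm_isSymm hs φ))
  rw [extCovDeriv_add_conformalDifference hs hsymm, conformalSchouten, extCovDeriv_sub,
    extCovDeriv_sub, extCovDeriv_hessian hD, extCovDeriv_stressForm hs hu hD hΓ hh,
    kulkarniNomizu_sub, kulkarniNomizu_sub, vecMul_sub, vecMul_sub,
    differential_vecMul_kulkarniNomizu_stressForm hs hu, hcurv]
  abel

end ConformalChange

section ParallelField

variable {R A ι : Type*} [CommRing R] [CommRing A] [Algebra R A] [Fintype ι]
  {D : ι → Derivation R A A} {Γ : ι → Matrix ι ι A} {h Q : Matrix ι ι A} {X : ι → A}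

lemma vecDeriv_mulVec_of_parallel (hh : IsParallelForm D Γ h)
    (hX : ∀ i, vecDeriv (D i) X = -(Γ i *ᵥ X)) (i : ι) :
    vecDeriv (D i) (h *ᵥ X) = (h *ᵥ X) ᵥ* Γ i := by
  rw [vecDeriv_mulVec, hh i, hX, add_mulVec, mulVec_neg, ← mulVec_mulVec, ← mulVec_mulVec,
    mulVec_transpose, add_neg_cancel_comm]

lemma derivation_normSq_of_parallel (hh : IsParallelForm D Γ h)
    (hX : ∀ i, vecDeriv (D i) X = -(Γ i *ᵥ X)) (i : ι) : D i (X ⬝ᵥ h *ᵥ X) = 0 := by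
  rw [derivation_dotProduct, vecDeriv_mulVec_of_parallel hh hX, hX, neg_dotProduct,
    dotProduct_comm X, ← dotProduct_mulVec, dotProduct_comm (h *ᵥ X), neg_add_cancel]

variable [DecidableEq ι]

lemma covDeriv_kulkarniNomizu (hu : IsUnit h.det) (hh : IsParallelForm D Γ h)
    (hQ : IsParallelForm D Γ Q) (a i j : ι) :
    covDeriv D Γ a (kulkarniNomizu h Q i j)
      = vecMulVec ((Γ a).col i) (Q j) + vecMulVec (Pi.single i 1) ((Γ a).col j ᵥ* Q)
        - (vecMulVec ((Γ a).col j) (Q i) + vecMulVec (Pi.single j 1) ((Γ a).col i ᵥ* Q))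
        + (vecMulVec (h⁻¹ *ᵥ ((Γ a).col i ᵥ* Q)) (h j)
          + vecMulVec (h⁻¹ *ᵥ Q i) ((Γ a).col j ᵥ* h))
        - (vecMulVec (h⁻¹ *ᵥ ((Γ a).col j ᵥ* Q)) (h i)
          + vecMulVec (h⁻¹ *ᵥ Q j) ((Γ a).col i ᵥ* h)) := by
  simp only [kulkarniNomizu, covDeriv_add, covDeriv_sub, covDeriv_vecMulVec,
    vecDeriv_single_one_add, vecDeriv_inv_mulVec_add hu hh, hh.vecDeriv_row, hQ.vecDeriv_row,
    add_sub_cancel_left]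

lemma cyclic_derivation_smul_kulkarniNomizu (hu : IsUnit h.det) (hD : IsHolonomic D)
    (hΓ : IsTorsionFree Γ) (hh : IsParallelForm D Γ h) (hQ : IsParallelForm D Γ Q) {K : A}
    (hcurv : ∀ i j, curvature D Γ i j = K • kulkarniNomizu h Q i j) (a i j : ι) :
    D a K • kulkarniNomizu h Q i j + D i K • kulkarniNomizu h Q j a
      + D j K • kulkarniNomizu h Q a i = 0 := by
  have hcyclic : covDeriv D Γ a (kulkarniNomizu h Q i j) + covDeriv D Γ i (kulkarniNomizu h Q j a)
      + covDeriv D Γ j (kulkarniNomizu h Q a i) = 0 := by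
    simp only [covDeriv_kulkarniNomizu hu hh hQ, hΓ i a, hΓ j a, hΓ j i]
    abel
  have hbianchi := curvature_bianchi_second (Γ := Γ) hD a i j
  simp only [hcurv, covDeriv_smul] at hbianchi
  linear_combination (norm := module) hbianchi - K • hcyclic

end ParallelField

section SplitForm

variable {R A ι : Type*} [CommRing R] [CommRing A] [Algebra R A] [Invertible (2 : A)] [Fintype ι]
  {h : Matrix ι ι A} {X : ι → A}

/-- The bilinear form `½ h - ξ ⊗ ξ / |X|²` with `ξ = h X`. In dimension three it is the Schouten
tensor of the product of a line in direction `X` with a surface of Gauss curvature one. -/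
def splitForm (h : Matrix ι ι A) (X : ι → A) : Matrix ι ι A :=
  ⅟(2 : A) • h - Ring.inverse (X ⬝ᵥ h *ᵥ X) • vecMulVec (h *ᵥ X) (h *ᵥ X)

lemma splitForm_row (i : ι) :
    splitForm h X i
      = ⅟(2 : A) • h i - (Ring.inverse (X ⬝ᵥ h *ᵥ X) * (h *ᵥ X) i) • h *ᵥ X := by
  rw [mul_smul]
  rfl

lemma splitForm_isSymm (hs : h.IsSymm) : (splitForm h X).IsSymm := by
  rw [IsSymm, splitForm, transpose_sub, transpose_smul, transpose_smul, transpose_vecMulVec, hs.eq]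

lemma splitForm_mulVec (hX : IsUnit (X ⬝ᵥ h *ᵥ X)) :
    splitForm h X *ᵥ X = -(⅟(2 : A) • h *ᵥ X) := by
  have hinv := Ring.inverse_mul_cancel _ hX
  rw [splitForm, sub_mulVec, smul_mulVec, smul_mulVec, vecMulVec_mulVec, op_smul_eq_smul,
    dotProduct_comm (h *ᵥ X) X, smul_smul, hinv]
  linear_combination (norm := module) invOf_mul_self (2 : A) • h *ᵥ X

lemma splitForm_isParallelForm {D : ι → Derivation R A A} {Γ : ι → Matrix ι ι A}
    (hh : IsParallelForm D Γ h) (hX : ∀ i, vecDeriv (D i) X = -(Γ i *ᵥ X))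
    (hn : IsUnit (X ⬝ᵥ h *ᵥ X)) : IsParallelForm D Γ (splitForm h X) := by
  intro i
  have hinv : D i (Ring.inverse (X ⬝ᵥ h *ᵥ X)) = 0 := by
    rw [Derivation.leibniz_of_mul_eq_one _ (Ring.inverse_mul_cancel _ hn),
      derivation_normSq_of_parallel hh hX, smul_zero]
  have hξ := vecDeriv_mulVec_of_parallel hh hX i
  rw [splitForm, map_sub, matDeriv_smul, matDeriv_smul, derivation_invOf_two, hinv, hh i,
    matDeriv_vecMulVec, hξ, Matrix.sub_mul, Matrix.mul_sub, Matrix.smul_mul, Matrix.smul_mul,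
    Matrix.mul_smul, Matrix.mul_smul, vecMulVec_mul, mul_vecMulVec, mulVec_transpose]
  module

variable [DecidableEq ι]

lemma inv_mulVec_splitForm_row (hs : h.IsSymm) (hu : IsUnit h.det) (i : ι) :
    h⁻¹ *ᵥ splitForm h X i
      = ⅟(2 : A) • Pi.single i 1 - (Ring.inverse (X ⬝ᵥ h *ᵥ X) * (h *ᵥ X) i) • X := by
  rw [splitForm_row, mulVec_sub, mulVec_smul, mulVec_smul, inv_mulVec_row hs hu, mulVec_mulVec,
    nonsing_inv_mul _ hu, one_mulVec]

lemma kulkarniNomizu_splitForm_mulVec (hs : h.IsSymm) (hu : IsUnit h.det)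
    (hn : IsUnit (X ⬝ᵥ h *ᵥ X)) (i j : ι) :
    kulkarniNomizu h (splitForm h X) i j *ᵥ X = 0 := by
  have hrow : ∀ k, splitForm h X k ⬝ᵥ X = -(⅟2 * (h *ᵥ X) k) := congrFun (splitForm_mulVec hn)
  have hlower : ∀ k, h k ⬝ᵥ X = (h *ᵥ X) k := fun _ => rfl
  simp only [kulkarniNomizu, add_mulVec, sub_mulVec, vecMulVec_mulVec, op_smul_eq_smul,
    inv_mulVec_splitForm_row hs hu, hrow, hlower]
  module

lemma sum_smul_kulkarniNomizu_splitForm (hs : h.IsSymm) (hu : IsUnit h.det)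
    (hn : IsUnit (X ⬝ᵥ h *ᵥ X)) (j : ι) :
    ∑ a, X a • kulkarniNomizu h (splitForm h X) j a = 0 := by
  have hΩ := isCurvatureTensor_mul_kulkarniNomizu hs hu (splitForm_isSymm (X := X) hs)
  have hlower : h * ∑ a, X a • kulkarniNomizu h (splitForm h X) j a = 0 := by
    ext k l
    have hker := congrFun (congrArg (h *ᵥ ·) (kulkarniNomizu_splitForm_mulVec hs hu hn k l)) j
    simp only [mulVec_mulVec, mulVec_zero, Pi.zero_apply] at hker
    rw [Matrix.zero_apply, ← hker, Matrix.mul_sum, Matrix.sum_apply, mulVec, dotProduct]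
    refine Finset.sum_congr rfl fun a _ => ?_
    rw [Matrix.mul_smul, Matrix.smul_apply, hΩ.pair_symm j a, smul_eq_mul, mul_comm]
  rw [← Matrix.one_mul (∑ a, _), ← nonsing_inv_mul _ hu, Matrix.mul_assoc, hlower, Matrix.mul_zero]

lemma metricTrace_splitForm (hs : h.IsSymm) (hu : IsUnit h.det) (hn : IsUnit (X ⬝ᵥ h *ᵥ X)) :
    metricTrace h (splitForm h X) = Fintype.card ι * ⅟2 - 1 := by
  have hnorm : ∑ i, Ring.inverse (X ⬝ᵥ h *ᵥ X) * (h *ᵥ X) i * X i = 1 := by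
    simp only [mul_assoc, ← Finset.mul_sum, ← dotProduct.eq_1]
    rw [dotProduct_comm (h *ᵥ X) X, Ring.inverse_mul_cancel _ hn]
  simp only [metricTrace, inv_mulVec_splitForm_row hs hu, Pi.sub_apply, Pi.smul_apply,
    Pi.single_eq_same, smul_eq_mul, mul_one, Finset.sum_sub_distrib, hnorm, Finset.sum_const,
    Finset.card_univ, nsmul_eq_mul]

lemma metricTrace_ricciContraction_kulkarniNomizu_splitForm (hs : h.IsSymm) (hu : IsUnit h.det)
    (hn : IsUnit (X ⬝ᵥ h *ᵥ X)) :
    metricTrace h (ricciContraction (kulkarniNomizu h (splitForm h X)))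
      = (Fintype.card ι - 1) * (Fintype.card ι - 2) := by
  rw [metricTrace_ricciContraction_kulkarniNomizu hs hu, metricTrace_splitForm hs hu hn]
  linear_combination (Fintype.card ι * (Fintype.card ι - 1) : A) * invOf_mul_self (2 : A)

lemma dotProduct_differential_mul_eq_zero {D : ι → Derivation R A A} {Γ : ι → Matrix ι ι A}
    (hs : h.IsSymm) (hu : IsUnit h.det) (hD : IsHolonomic D) (hΓ : IsTorsionFree Γ)
    (hh : IsParallelForm D Γ h) (hX : ∀ i, vecDeriv (D i) X = -(Γ i *ᵥ X))
    (hn : IsUnit (X ⬝ᵥ h *ᵥ X)) {K : A}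
    (hcurv : ∀ i j, curvature D Γ i j = K • kulkarniNomizu h (splitForm h X) i j) :
    (X ⬝ᵥ differential D K) * ((Fintype.card ι - 1) * (Fintype.card ι - 2)) = 0 := by
  have hcyclic := cyclic_derivation_smul_kulkarniNomizu hu hD hΓ hh
    (splitForm_isParallelForm hh hX hn) hcurv
  have hzero : ∀ i j,
      (X ⬝ᵥ differential D K) • kulkarniNomizu h (splitForm h X) i j = 0 := fun i j => by
    have hswap : ∀ a, kulkarniNomizu h (splitForm h X) a i
        = -kulkarniNomizu h (splitForm h X) i a := fun a => by
      simp only [kulkarniNomizu]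
      abel
    calc (X ⬝ᵥ differential D K) • kulkarniNomizu h (splitForm h X) i j
        = ∑ a, X a • (D a K • kulkarniNomizu h (splitForm h X) i j
            + D i K • kulkarniNomizu h (splitForm h X) j a
            + D j K • kulkarniNomizu h (splitForm h X) a i)
          - D i K • ∑ a, X a • kulkarniNomizu h (splitForm h X) j a
          + D j K • ∑ a, X a • kulkarniNomizu h (splitForm h X) i a := by
          simp only [hswap, smul_add, smul_neg, Finset.sum_add_distrib, Finset.sum_neg_distrib,
            Finset.smul_sum, smul_comm (D _ K) (X _), dotProduct, Finset.sum_smul, smul_smul,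
            differential_apply]
          abel
      _ = 0 := by
          simp only [hcyclic, sum_smul_kulkarniNomizu_splitForm hs hu hn, smul_zero,
            Finset.sum_const_zero, sub_zero, add_zero]
  rw [← metricTrace_ricciContraction_kulkarniNomizu_splitForm hs hu hn, ← metricTrace_smul,
    ← ricciContraction_smul]
  simp only [hzero, ricciContraction, metricTrace, Matrix.zero_apply, Finset.sum_const_zero]
  exact Finset.sum_eq_zero fun i _ => congrFun (mulVec_zero h⁻¹) i

end SplitForm

section DimensionThree

variable {A : Type*} [CommRing A]

/-- The matrix of the cross product with `v`. -/
def crossMatrix (v : Fin 3 → A) : Matrix (Fin 3) (Fin 3) A :=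
  !![0, -v 2, v 1; v 2, 0, -v 0; -v 1, v 0, 0]

/-- The vector `v` with `M = crossMatrix v`, for a skew-symmetric matrix `M`. -/
def axialVector (M : Matrix (Fin 3) (Fin 3) A) : Fin 3 → A := ![M 2 1, M 0 2, M 1 0]

lemma crossMatrix_mulVec (v w : Fin 3 → A) : crossMatrix v *ᵥ w = v ⨯₃ w := by
  ext i
  simp only [cross_apply, crossMatrix, mulVec, vec3_dotProduct, of_apply]
  fin_cases i <;> simp only [Fin.reduceFinMk, Fin.zero_eta, Fin.mk_one, cons_val] <;> ring

lemma crossMatrix_smul (a : A) (v : Fin 3 → A) : crossMatrix (a • v) = a • crossMatrix v := by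
  simp [crossMatrix]

lemma axialVector_smul (a : A) (M : Matrix (Fin 3) (Fin 3) A) :
    axialVector (a • M) = a • axialVector M := by
  simp [axialVector]

lemma axialVector_crossMatrix (v : Fin 3 → A) : axialVector (crossMatrix v) = v := by
  ext i
  fin_cases i <;> rfl

variable [Invertible (2 : A)]

lemma crossMatrix_axialVector {S : Matrix (Fin 3) (Fin 3) A} (hS : Sᵀ = -S) :
    crossMatrix (axialVector S) = S := by
  have skew : ∀ i j, S j i = -S i j := fun i j => congrFun (congrFun hS i) j
  have diag : ∀ i, S i i = 0 := fun i =>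
    (isUnit_of_invertible (2 : A)).mul_left_cancel (by linear_combination skew i i)
  ext i j
  fin_cases i <;> fin_cases j <;>
    simp [crossMatrix, axialVector, diag, skew 0 1, skew 0 2, skew 1 2]

lemma smul_eq_smul_crossMatrix_of_mulVec_eq_zero {S : Matrix (Fin 3) (Fin 3) A} (hS : Sᵀ = -S)
    {X : Fin 3 → A} (hX : S *ᵥ X = 0) (ξ : Fin 3 → A) :
    (ξ ⬝ᵥ X) • S = (ξ ⬝ᵥ axialVector S) • crossMatrix X := by
  have haxial : axialVector S ⨯₃ X = 0 := by
    rw [← crossMatrix_mulVec, crossMatrix_axialVector hS, hX]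
  have hprop : (ξ ⬝ᵥ X) • axialVector S = (ξ ⬝ᵥ axialVector S) • X := by
    rw [← sub_eq_zero, dotProduct_comm ξ (axialVector S),
      ← cross_cross_eq_smul_sub_smul', haxial, map_zero]
  rw [← crossMatrix_smul, ← hprop, crossMatrix_smul, crossMatrix_axialVector hS]

lemma IsCurvatureTensor.exists_eq_smul_crossMatrix {Ω : Fin 3 → Fin 3 → Matrix (Fin 3) (Fin 3) A}
    (hΩ : IsCurvatureTensor Ω) {X ξ : Fin 3 → A} (hX : ∀ i j, Ω i j *ᵥ X = 0)
    (hξ : IsUnit (ξ ⬝ᵥ X)) :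
    ∃ κ, ∀ i j, Ω i j = (κ * crossMatrix X i j) • crossMatrix X := by
  obtain ⟨c, hc⟩ := hξ.exists_left_inv
  let C : Matrix (Fin 3) (Fin 3) A := of fun i j => c * (ξ ⬝ᵥ axialVector (Ω i j))
  have hΩC : ∀ i j, Ω i j = C i j • crossMatrix X := fun i j => by
    have hprop := smul_eq_smul_crossMatrix_of_mulVec_eq_zero (hΩ.skew i j) (hX i j) ξ
    rw [show C i j = c * (ξ ⬝ᵥ axialVector (Ω i j)) from rfl, mul_smul, ← hprop, smul_smul, hc,
      one_smul]
  have hC : ∀ i j, C i j = c * (ξ ⬝ᵥ axialVector C) * crossMatrix X i j := fun i j => by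
    have hpair : C i j • crossMatrix X = crossMatrix X i j • C := by
      ext k l
      have hsymm := hΩ.pair_symm i j k l
      rw [hΩC i j, hΩC k l] at hsymm
      exact hsymm.trans (mul_comm _ _)
    have haxial := congrArg (ξ ⬝ᵥ axialVector ·) hpair
    simp only [axialVector_smul, axialVector_crossMatrix, dotProduct_smul, smul_eq_mul] at haxial
    linear_combination c * haxial - C i j * hc
  exact ⟨_, fun i j => by rw [← hC, hΩC]⟩

variable {R : Type*} [CommRing R] [Algebra R A] {D : Fin 3 → Derivation R A A}
  {Γ : Fin 3 → Matrix (Fin 3) (Fin 3) A} {h : Matrix (Fin 3) (Fin 3) A} {X : Fin 3 → A}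

lemma exists_curvature_eq_smul_kulkarniNomizu_splitForm (hs : h.IsSymm) (hu : IsUnit h.det)
    (hD : IsHolonomic D) (hΓ : IsTorsionFree Γ) (hh : IsParallelForm D Γ h)
    (hX : ∀ i, vecDeriv (D i) X = -(Γ i *ᵥ X)) (hn : IsUnit (X ⬝ᵥ h *ᵥ X)) :
    ∃ K : A, ∀ i j, curvature D Γ i j = K • kulkarniNomizu h (splitForm h X) i j := by
  have raise : ∀ M : Matrix (Fin 3) (Fin 3) A, M = h⁻¹ * (h * M) := fun M => by
    rw [← Matrix.mul_assoc, nonsing_inv_mul _ hu, Matrix.one_mul]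
  have lowered : ∀ M : Matrix (Fin 3) (Fin 3) A, M *ᵥ X = 0 → (h * M) *ᵥ X = 0 := fun M hM => by
    rw [← mulVec_mulVec, hM, mulVec_zero]
  let B : Fin 3 → Fin 3 → Matrix (Fin 3) (Fin 3) A := fun i j =>
    h⁻¹ * (crossMatrix X i j • crossMatrix X)
  obtain ⟨κ, hκ⟩ := (isCurvatureTensor_mul_curvature hs hD hΓ hh).exists_eq_smul_crossMatrix
    (fun i j => lowered _ (curvature_mulVec_eq_zero hD hX i j)) (dotProduct_comm X _ ▸ hn)
  obtain ⟨μ, hμ⟩ := (isCurvatureTensor_mul_kulkarniNomizu hs hu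
    (splitForm_isSymm (X := X) hs)).exists_eq_smul_crossMatrix
    (fun i j => lowered _ (kulkarniNomizu_splitForm_mulVec hs hu hn i j))
    (dotProduct_comm X _ ▸ hn)
  have hcurv : ∀ i j, curvature D Γ i j = κ • B i j := fun i j => by
    rw [raise (curvature D Γ i j), hκ, mul_smul, Matrix.mul_smul]
  have hsplit : ∀ i j, kulkarniNomizu h (splitForm h X) i j = μ • B i j := fun i j => by
    rw [raise (kulkarniNomizu h (splitForm h X) i j), hμ, mul_smul, Matrix.mul_smul]
  have htrace : μ * metricTrace h (ricciContraction B) = 2 := by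
    rw [← metricTrace_smul, ← ricciContraction_smul, ← funext₂ hsplit,
      metricTrace_ricciContraction_kulkarniNomizu_splitForm hs hu hn, Fintype.card_fin]
    norm_num
  refine ⟨κ * metricTrace h (ricciContraction B) * ⅟2, fun i j => ?_⟩
  rw [hcurv, hsplit, smul_smul]
  congr 1
  linear_combination -(κ * invOf_mul_self (2 : A)) - κ * ⅟2 * htrace

/-- The Ricci tensor of the metric `h`. -/
def ricciForm (D : Fin 3 → Derivation R A A) (h : Matrix (Fin 3) (Fin 3) A) :
    Matrix (Fin 3) (Fin 3) A :=
  ricciContraction (curvature D (leviCivita D h))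

/-- The Schouten tensor of the metric `h` in dimension three. -/
def schoutenForm (D : Fin 3 → Derivation R A A) (h : Matrix (Fin 3) (Fin 3) A) :
    Matrix (Fin 3) (Fin 3) A :=
  ricciForm D h - (⅟2 * ⅟2 * metricTrace h (ricciForm D h)) • h

lemma schoutenForm_eq (hs : h.IsSymm) (hu : IsUnit h.det) {Q : Matrix (Fin 3) (Fin 3) A}
    (hQ : ∀ i j, curvature D (leviCivita D h) i j = kulkarniNomizu h Q i j) :
    schoutenForm D h = Q := by
  rw [schoutenForm, ricciForm, funext₂ hQ, metricTrace_ricciContraction_kulkarniNomizu hs hu,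
    ricciContraction_kulkarniNomizu hs hu, Fintype.card_fin]
  have hquarter : ⅟2 * ⅟2 * (2 * ((3 : ℕ) - 1) * metricTrace h Q) = metricTrace h Q := by
    linear_combination metricTrace h Q * (2 * ⅟2 + 1) * invOf_mul_self (2 : A)
  rw [hquarter]
  module

lemma exists_extCovDeriv_schoutenForm_smul (hs : h.IsSymm) (hu : IsUnit h.det)
    (hD : IsHolonomic D) (hX : ∀ i, vecDeriv (D i) X = -(leviCivita D h i *ᵥ X))
    (hn : IsUnit (X ⬝ᵥ h *ᵥ X)) {w φ : A} (hw : IsUnit w) (hφ : ∀ i, D i w = 2 * w * D i φ) :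
    ∃ K, X ⬝ᵥ differential D K = 0 ∧ ∀ i j,
      extCovDeriv D (leviCivita D (w • h)) (schoutenForm D (w • h)) i j
        = D i K • splitForm h X j - D j K • splitForm h X i := by
  have hΓ : IsTorsionFree (leviCivita D h) := leviCivita_isTorsionFree hs
  have hh := leviCivita_isParallelForm (D := D) hs hu
  obtain ⟨K, hK⟩ := exists_curvature_eq_smul_kulkarniNomizu_splitForm hs hu hD hΓ hh hX hn
  have hcurv : ∀ i j, curvature D (leviCivita D h) i j = kulkarniNomizu h (K • splitForm h X) i j :=
    fun i j => by rw [hK, kulkarniNomizu_smul]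
  have hconn : leviCivita D (w • h) = leviCivita D h + conformalDifference D h φ :=
    funext (leviCivita_smul hs hu hw hφ)
  have hschouten : schoutenForm D (w • h)
      = K • splitForm h X - conformalSchouten D (leviCivita D h) h φ := by
    refine schoutenForm_eq (hs.smul w) ?_ fun i j => ?_
    · rw [det_smul]
      exact (hw.pow _).mul hu
    · rw [hconn, curvature_add_conformalDifference hs hu hD hΓ hh, hcurv,
        kulkarniNomizu_smul_left hu hw, kulkarniNomizu_sub]
  refine ⟨K, ?_, fun i j => ?_⟩
  · have hzero := dotProduct_differential_mul_eq_zero hs hu hD hΓ hh hX hn hK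
    refine (isUnit_of_invertible (2 : A)).mul_left_cancel ?_
    rw [Fintype.card_fin] at hzero
    linear_combination hzero
  · rw [hschouten, hconn, extCovDeriv_sub_conformalSchouten hs hu hD hΓ hh
      ((splitForm_isSymm hs).smul K) hcurv, extCovDeriv_smul_of_isParallelForm hΓ
      (splitForm_isParallelForm hh hX hn)]

end DimensionThree

section PartialDerivatives

open TopologicalSpace

variable {n : ℕ} {F G : Model n → ℝ} {U : Opens (Model n)}

lemma contDiffOn_pd (hF : ContDiffOn ℝ ∞ F U) (i : Fin n) :
    ContDiffOn ℝ ∞ (pd i F) U :=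
  (hF.fderiv_of_isOpen U.2 (by simp)).clm_apply contDiffOn_const

lemma pd_congr (h : ∀ x : U, F x = G x) (i : Fin n) (x : U) :
    pd i F x = pd i G x := by
  have hFG : F =ᶠ[nhds (x : Model n)] G :=
    Filter.eventually_of_mem (U.2.mem_nhds x.2) fun y hy => h ⟨y, hy⟩
  rw [pd, pd, hFG.fderiv_eq]

lemma pd_pd_eq_fderiv_fderiv {x : Model n} (hF : ContDiffAt ℝ 2 F x)
    (i j : Fin n) : pd i (pd j F) x
      = fderiv ℝ (fderiv ℝ F) x (EuclideanSpace.single i 1) (EuclideanSpace.single j 1) := by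
  have hd : DifferentiableAt ℝ (fderiv ℝ F) x :=
    (hF.fderiv_right (m := 1) (by norm_num)).differentiableAt (by simp)
  change fderiv ℝ (fun y => fderiv ℝ F y (EuclideanSpace.single j 1)) x _ = _
  rw [fderiv_clm_apply hd (differentiableAt_const _)]
  simp

lemma pd_comm {x : Model n} (hF : ContDiffAt ℝ 2 F x) (i j : Fin n) :
    pd i (pd j F) x = pd j (pd i F) x := by
  rw [pd_pd_eq_fderiv_fderiv hF, pd_pd_eq_fderiv_fderiv hF]
  exact (hF.isSymmSndFDerivAt (by simp)).eq _ _

end PartialDerivatives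

section SmoothFunctions

open TopologicalSpace

variable {n : ℕ}

/-- The algebra of smooth functions on an open subset of `ℝⁿ`. -/
abbrev SmoothFunction (U : Opens (Model n)) : Type := C^∞⟮𝓘(ℝ, Model n), U; 𝓘(ℝ), ℝ⟯

namespace SmoothFunction

variable {U : Opens (Model n)}

instance : Invertible (2 : SmoothFunction U) :=
  letI : Invertible (2 : ℝ) := invertibleOfNonzero two_ne_zero
  (Invertible.map (algebraMap ℝ (SmoothFunction U)) 2).copy 2 (map_ofNat _ 2).symm

/-- Evaluation of smooth functions at a point. -/
def eval (x : U) : SmoothFunction U →ₐ[ℝ] ℝ :=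
  (Pi.evalAlgHom ℝ (fun _ : U => ℝ) x).comp ContMDiffMap.coeFnAlgHom

lemma eval_injective {a b : SmoothFunction U} (h : ∀ x, eval x a = eval x b) : a = b :=
  ContMDiffMap.ext h

lemma eval_invOf_two (x : U) : eval x ⅟2 = 1 / 2 := by
  refine eq_one_div_of_mul_eq_one_left ?_
  rw [← map_ofNat (eval x) 2, ← map_mul, invOf_mul_self, map_one]

lemma isUnit_of_eval_ne_zero {a : SmoothFunction U} (ha : ∀ x, eval x a ≠ 0) : IsUnit a :=
  .of_mul_eq_one (⟨fun x => (a x)⁻¹, a.contMDiff.inv₀ ha⟩ : SmoothFunction U) <|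
    eval_injective fun x => mul_inv_cancel₀ (ha x)

/-- The pointwise exponential of a smooth function. -/
def exp (a : SmoothFunction U) : SmoothFunction U :=
  ⟨fun x => Real.exp (a x), Real.contDiff_exp.contMDiff.comp a.contMDiff⟩

lemma eval_exp (a : SmoothFunction U) (x : U) : eval x (exp a) = Real.exp (eval x a) := rfl

/-- The restriction to `U` of a function on `ℝⁿ` that is smooth on `U`. -/
def ofContDiffOn {F : Model n → ℝ} (hF : ContDiffOn ℝ ∞ F U) : SmoothFunction U :=
  ⟨fun x => F x, fun x =>
    contMDiffAt_subtype_iff.2 (hF.contDiffAt (U.2.mem_nhds x.2)).contMDiffAt⟩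

lemma eval_ofContDiffOn {F : Model n → ℝ} (hF : ContDiffOn ℝ ∞ F U) (x : U) :
    eval x (ofContDiffOn hF) = F x := rfl

/-- The extension by zero of a function on `U`. -/
def extension (a : SmoothFunction U) : Model n → ℝ := Function.extend Subtype.val a 0

lemma extension_apply (a : SmoothFunction U) (x : U) : extension a x = eval x a :=
  Subtype.val_injective.extend_apply a 0 x

lemma contDiffAt_extension (a : SmoothFunction U) (x : U) : ContDiffAt ℝ ∞ (extension a) x := by
  refine (contMDiffAt_subtype_iff (U := U).1 ?_).contDiffAt
  simp only [extension_apply]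
  exact a.contMDiff x

lemma differentiableAt_extension (a : SmoothFunction U) (x : U) :
    DifferentiableAt ℝ (extension a) x :=
  (contDiffAt_extension a x).differentiableAt (by simp)

lemma contDiffOn_extension (a : SmoothFunction U) : ContDiffOn ℝ ∞ (extension a) U :=
  fun x hx => (contDiffAt_extension a ⟨x, hx⟩).contDiffWithinAt

/-- The partial derivative `∂ᵢ` as a derivation of the algebra of smooth functions. -/
def partialDeriv (U : Opens (Model n)) (i : Fin n) :
    Derivation ℝ (SmoothFunction U) (SmoothFunction U) :=
  Derivation.mk'
    { toFun := fun a => ofContDiffOn (contDiffOn_pd (contDiffOn_extension a) i)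
      map_add' := fun a b => eval_injective fun x => by
        rw [map_add]
        simp only [eval_ofContDiffOn]
        rw [pd_congr (G := extension a + extension b) (fun y => by simp [extension_apply]), pd,
          fderiv_add (differentiableAt_extension a x) (differentiableAt_extension b x)]
        rfl
      map_smul' := fun r a => eval_injective fun x => by
        rw [map_smul]
        simp only [eval_ofContDiffOn]
        rw [pd_congr (G := r • extension a) (fun y => by simp [extension_apply]), pd,
          fderiv_const_smul (differentiableAt_extension a x)]
        rfl }
    fun a b => eval_injective fun x => by
      simp only [smul_eq_mul, map_add, map_mul, LinearMap.coe_mk, AddHom.coe_mk, eval_ofContDiffOn]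
      rw [pd_congr (G := extension a * extension b) (fun y => by simp [extension_apply]), pd,
        fderiv_mul (differentiableAt_extension a x) (differentiableAt_extension b x),
        extension_apply, extension_apply]
      rfl

lemma pd_eq_eval_partialDeriv {F : Model n → ℝ} {a : SmoothFunction U}
    (h : ∀ x : U, F x = eval x a) (i : Fin n) (x : U) : pd i F x = eval x (partialDeriv U i a) :=
  pd_congr (fun y => by rw [h, extension_apply]) i x

lemma partialDeriv_exp (a : SmoothFunction U) (i : Fin n) :
    partialDeriv U i (exp a) = exp a * partialDeriv U i a := by
  refine eval_injective fun x => ?_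
  have hexp : ∀ y : U, Real.exp (extension a y) = eval y (exp a) := fun y => by
    rw [extension_apply, eval_exp]
  rw [map_mul, ← hexp x, ← pd_eq_eval_partialDeriv (F := fun y => Real.exp (extension a y)) hexp,
    ← pd_eq_eval_partialDeriv (extension_apply a), pd,
    (differentiableAt_extension a x).hasFDerivAt.exp.fderiv]
  rfl

lemma partialDeriv_exp_two_mul (a : SmoothFunction U) (i : Fin n) :
    partialDeriv U i (exp (2 * a)) = 2 * exp (2 * a) * partialDeriv U i a := by
  rw [partialDeriv_exp, two_mul a, map_add]
  ring

lemma isHolonomic_partialDeriv (U : Opens (Model n)) : IsHolonomic (partialDeriv U) := by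
  refine fun i j a => eval_injective fun x => ?_
  have hpd : ∀ i j, eval x (partialDeriv U i (partialDeriv U j a)) = pd i (pd j (extension a)) x :=
    fun i j => (pd_eq_eval_partialDeriv (fun _ => rfl) i x).symm
  rw [hpd, hpd, pd_comm ((contDiffAt_extension a x).of_le (by norm_cast))]

end SmoothFunction

end SmoothFunctions

section LocalGeometry

open TopologicalSpace SmoothFunction

variable {n : ℕ} {U : Opens (Model n)} {G : Model n → Matrix (Fin n) (Fin n) ℝ}
  {γ : Matrix (Fin n) (Fin n) (SmoothFunction U)}

lemma inv_eq_map_eval (hu : IsUnit γ.det) (hG : ∀ x : U, G x = γ.map (eval x)) (x : U) :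
    (G x)⁻¹ = γ⁻¹.map (eval x) := by
  refine inv_eq_right_inv ?_
  rw [hG, ← Matrix.map_mul, mul_nonsing_inv γ hu]
  exact Matrix.map_one _ (map_zero _) (map_one _)

lemma christoffel_eq_eval_leviCivita (hu : IsUnit γ.det) (hG : ∀ x : U, G x = γ.map (eval x))
    (k i j : Fin n) (x : U) :
    christoffel G k i j x = eval x (leviCivita (partialDeriv U) γ i k j) := by
  have hpd : ∀ a b c, pd c (fun y => G y a b) x = eval x (partialDeriv U c (γ a b)) :=
    fun a b c => pd_eq_eval_partialDeriv (fun y => by rw [hG, map_apply]) c x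
  simp only [christoffel, leviCivita, inv_eq_map_eval hu hG, hpd, Matrix.smul_apply,
    Matrix.mul_apply, of_apply, map_apply, smul_eq_mul, map_mul, map_sum,
    map_add, map_sub, eval_invOf_two]

lemma riemann_eq_eval_curvature (hu : IsUnit γ.det) (hG : ∀ x : U, G x = γ.map (eval x))
    (l i j k : Fin n) (x : U) :
    riemann G l i j k x
      = eval x (curvature (partialDeriv U) (leviCivita (partialDeriv U) γ) i j l k) := by
  have hΓ := christoffel_eq_eval_leviCivita hu hG
  simp only [riemann, curvature, Ring.lie_def, pd_eq_eval_partialDeriv (hΓ _ _ _), hΓ,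
    Matrix.add_apply, Matrix.sub_apply, matDeriv_apply, Matrix.mul_apply, map_add, map_sub,
    map_sum, map_mul, Finset.sum_sub_distrib]

end LocalGeometry

section LocalGeometryDimensionThree

open TopologicalSpace SmoothFunction

variable {U : Opens (Model 3)} {G : Model 3 → Matrix (Fin 3) (Fin 3) ℝ}
  {γ : Matrix (Fin 3) (Fin 3) (SmoothFunction U)}

lemma ricci_eq_eval_ricciForm (hu : IsUnit γ.det) (hG : ∀ x : U, G x = γ.map (eval x))
    (j k : Fin 3) (x : U) : ricci G j k x = eval x (ricciForm (partialDeriv U) γ j k) := by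
  simp only [ricci, riemann_eq_eval_curvature hu hG, ricciForm, ricciContraction, of_apply, map_sum]

lemma schouten_eq_eval_schoutenForm (hu : IsUnit γ.det) (hG : ∀ x : U, G x = γ.map (eval x))
    (j k : Fin 3) (x : U) : schouten G j k x = eval x (schoutenForm (partialDeriv U) γ j k) := by
  have hscalar : scalarCurv G x
      = eval x (metricTrace γ (ricciForm (partialDeriv U) γ)) := by
    simp only [scalarCurv, metricTrace, mulVec, dotProduct, inv_eq_map_eval hu hG,
      ricci_eq_eval_ricciForm hu hG, map_apply, map_sum, map_mul]
  simp only [schouten, hscalar, ricci_eq_eval_ricciForm hu hG, schoutenForm, Matrix.sub_apply,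
    Matrix.smul_apply, smul_eq_mul, map_sub, map_mul, eval_invOf_two, hG, map_apply]
  push_cast
  ring

lemma cotton_eq_eval_extCovDeriv (hs : γ.IsSymm) (hu : IsUnit γ.det)
    (hG : ∀ x : U, G x = γ.map (eval x)) (i j k : Fin 3) (x : U) :
    cotton G i j k x = eval x (extCovDeriv (partialDeriv U) (leviCivita (partialDeriv U) γ)
      (schoutenForm (partialDeriv U) γ) i j k) := by
  have hΓ := christoffel_eq_eval_leviCivita hu hG
  have hS := schouten_eq_eval_schoutenForm hu hG
  have htorsion : ∀ m, christoffel G m j i x = christoffel G m i j x := fun m => by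
    rw [hΓ, hΓ]
    exact congrArg (eval x) (congrFun (leviCivita_isTorsionFree hs j i) m)
  simp only [cotton, nablaSchouten, htorsion, extCovDeriv, vecDeriv_apply, vecMul, dotProduct,
    pd_eq_eval_partialDeriv (hS _ _), hS, hΓ, Pi.sub_apply, map_sub, map_sum, map_mul,
    mul_comm (eval x (leviCivita _ _ _ _ _))]
  ring

end LocalGeometryDimensionThree

section ParallelOn

open TopologicalSpace SmoothFunction

variable {n : ℕ}

/-- The field `V` is parallel for the metric with matrix `G` on the open set `U ⊆ ℝⁿ`, both being
smooth on `U`. -/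
structure IsParallelOn (U : Opens (Model n)) (G : Model n → Matrix (Fin n) (Fin n) ℝ)
    (V : Model n → Fin n → ℝ) : Prop where
  contDiffOn_metric : ∀ i j, ContDiffOn ℝ ∞ (fun x => G x i j) U
  contDiffOn_field : ∀ i, ContDiffOn ℝ ∞ (fun x => V x i) U
  isSymm : ∀ x ∈ U, (G x).IsSymm
  det_ne_zero : ∀ x ∈ U, (G x).det ≠ 0
  parallel : ∀ x ∈ U, ∀ i k,
    pd i (fun y => V y k) x + ∑ j, christoffel G k i j x * V x j = 0

namespace IsParallelOn

variable {U : Opens (Model n)} {G : Model n → Matrix (Fin n) (Fin n) ℝ} {V : Model n → Fin n → ℝ}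
  (H : IsParallelOn U G V)

include H

/-- The metric as a matrix over the algebra of smooth functions. -/
def metric : Matrix (Fin n) (Fin n) (SmoothFunction U) :=
  of fun i j => ofContDiffOn (H.contDiffOn_metric i j)

/-- The parallel field as a vector over the algebra of smooth functions. -/
def field : Fin n → SmoothFunction U := fun i => ofContDiffOn (H.contDiffOn_field i)

lemma eq_map_eval_metric (x : U) : G x = H.metric.map (eval x) := rfl

lemma isSymm_metric : H.metric.IsSymm :=
  IsSymm.ext fun i j => eval_injective fun x => (H.isSymm x x.2).apply i j

lemma isUnit_det_metric : IsUnit H.metric.det :=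
  isUnit_of_eval_ne_zero fun x => by
    rw [AlgHom.map_det]
    exact H.det_ne_zero x x.2

lemma vecDeriv_field (i : Fin n) : vecDeriv (partialDeriv U i) H.field
    = -(leviCivita (partialDeriv U) H.metric i *ᵥ H.field) := by
  ext k : 1
  refine eval_injective fun x => ?_
  have hpar := H.parallel x x.2 i k
  rw [pd_eq_eval_partialDeriv (a := H.field k) (fun _ => rfl)] at hpar
  simp only [christoffel_eq_eval_leviCivita H.isUnit_det_metric H.eq_map_eval_metric] at hpar
  rw [vecDeriv_apply, eq_neg_of_add_eq_zero_left hpar]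
  simp only [Pi.neg_apply, mulVec, dotProduct, map_neg, map_sum, map_mul]
  rfl

lemma map_eval_mulVec (M : Matrix (Fin n) (Fin n) (SmoothFunction U)) (x : U) :
    M.map (eval x) *ᵥ V x = eval x ∘ (M *ᵥ H.field) :=
  funext fun i => (RingHom.map_mulVec (eval x : SmoothFunction U →+* ℝ) M H.field i).symm

lemma eval_field_dotProduct (v : Fin n → SmoothFunction U) (x : U) :
    eval x (H.field ⬝ᵥ v) = V x ⬝ᵥ (eval x ∘ v) :=
  RingHom.map_dotProduct (eval x : SmoothFunction U →+* ℝ) H.field v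

lemma eval_normSq (x : U) :
    eval x (H.field ⬝ᵥ H.metric *ᵥ H.field) = V x ⬝ᵥ G x *ᵥ V x := by
  rw [H.eval_field_dotProduct, ← H.map_eval_mulVec, ← H.eq_map_eval_metric]

lemma pd_normSq (i : Fin n) (x : U) : pd i (fun y => V y ⬝ᵥ G y *ᵥ V y) x = 0 := by
  rw [pd_eq_eval_partialDeriv (fun y => (H.eval_normSq y).symm), derivation_normSq_of_parallel
    (leviCivita_isParallelForm H.isSymm_metric H.isUnit_det_metric) H.vecDeriv_field, map_zero]

end IsParallelOn

lemma IsParallelOn.exists_cotton_eq_of_conformal {U : Opens (Model 3)}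
    {G G' : Model 3 → Matrix (Fin 3) (Fin 3) ℝ} {V : Model 3 → Fin 3 → ℝ}
    (H : IsParallelOn U G' V) (hV : ∀ x ∈ U, V x ⬝ᵥ G' x *ᵥ V x ≠ 0) {f : Model 3 → ℝ}
    (hf : ContDiffOn ℝ ∞ f U) (hG : ∀ x ∈ U, G x = Real.exp (2 * f x) • G' x) (x : U) :
    ∃ (κ : Fin 3 → ℝ) (P : Matrix (Fin 3) (Fin 3) ℝ) (t : ℝ), V x ⬝ᵥ κ = 0 ∧ P.IsSymm ∧
      P *ᵥ V x = t • G x *ᵥ V x ∧ ∀ i j k, cotton G i j k x = κ i * P j k - κ j * P i k := by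
  let φ := ofContDiffOn hf
  let w := SmoothFunction.exp (2 * φ)
  have hn : IsUnit (H.field ⬝ᵥ H.metric *ᵥ H.field) :=
    isUnit_of_eval_ne_zero fun y => by
      rw [H.eval_normSq]
      exact hV y y.2
  have hw : IsUnit w := isUnit_of_eval_ne_zero fun y => (Real.exp_pos _).ne'
  have hGw : ∀ y : U, G y = (w • H.metric).map (eval y) := fun y => by
    ext i j
    rw [hG y y.2, map_apply, Matrix.smul_apply, Matrix.smul_apply, smul_eq_mul, smul_eq_mul,
      map_mul, eval_exp, map_mul, map_ofNat]
    rfl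
  have huw : IsUnit (w • H.metric).det := by
    rw [det_smul]
    exact (hw.pow _).mul H.isUnit_det_metric
  obtain ⟨K, hK, hcotton⟩ := exists_extCovDeriv_schoutenForm_smul H.isSymm_metric
    H.isUnit_det_metric (isHolonomic_partialDeriv U) H.vecDeriv_field hn hw
    (partialDeriv_exp_two_mul φ)
  refine ⟨eval x ∘ differential (partialDeriv U) K,
    (splitForm H.metric H.field).map (eval x), -(1 / 2) * Real.exp (-(2 * f x)), ?_, ?_, ?_, ?_⟩
  · rw [← H.eval_field_dotProduct, hK, map_zero]
  · exact (splitForm_isSymm H.isSymm_metric).map _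
  · rw [H.map_eval_mulVec, splitForm_mulVec hn, hG x x.2, smul_mulVec, smul_smul, mul_assoc,
      ← Real.exp_add, neg_add_cancel, Real.exp_zero, mul_one, neg_smul, H.eq_map_eval_metric,
      H.map_eval_mulVec]
    ext i
    simp only [Function.comp_apply, Pi.neg_apply, Pi.smul_apply, smul_eq_mul, map_neg, map_mul,
      eval_invOf_two]
  · intro i j k
    rw [cotton_eq_eval_extCovDeriv (H.isSymm_metric.smul w) huw hGw, hcotton]
    simp only [Pi.sub_apply, Pi.smul_apply, smul_eq_mul, map_sub, map_mul]
    rfl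

end ParallelOn

section CottonYorkAlgebra

lemma det_of_vec3_eq_sum_perm {R : Type*} [CommRing R] (a b c : Fin 3 → R) :
    (of ![a, b, c]).det = ∑ σ : Equiv.Perm (Fin 3),
      a (σ 0) * b (σ 1) * c (σ 2) * ((Equiv.Perm.sign σ : ℤ) : R) := by
  rw [← det_transpose, det_apply']
  refine Finset.sum_congr rfl fun σ _ => ?_
  rw [Fin.prod_univ_three, mul_comm]
  rfl

variable {G : Model 3 → Matrix (Fin 3) (Fin 3) ℝ} {x : Model 3} {κ : Fin 3 → ℝ}
  {P : Matrix (Fin 3) (Fin 3) ℝ}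

lemma sum_cotton_eq_det (hC : ∀ i j k, cotton G i j k x = κ i * P j k - κ j * P i k)
    (a β : Fin 3 → ℝ) :
    ∑ σ : Equiv.Perm (Fin 3), (∑ k, cotton G (σ 0) (σ 1) k x * a k) * β (σ 2)
      * ((Equiv.Perm.sign σ : ℤ) : ℝ) = 2 * (of ![κ, P *ᵥ a, β]).det := by
  have hswap : (of ![P *ᵥ a, κ, β]).det = -(of ![κ, P *ᵥ a, β]).det := by
    simp only [det_fin_three, of_apply, cons_val]
    ring
  have hcontract : ∀ i j, ∑ k, cotton G i j k x * a k = κ i * (P *ᵥ a) j - (P *ᵥ a) i * κ j :=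
    fun i j => by
      simp only [hC, mulVec, dotProduct, Fin.sum_univ_three]
      ring
  calc _ = (of ![κ, P *ᵥ a, β]).det - (of ![P *ᵥ a, κ, β]).det := by
        rw [det_of_vec3_eq_sum_perm, det_of_vec3_eq_sum_perm, ← Finset.sum_sub_distrib]
        exact Finset.sum_congr rfl fun σ _ => by rw [hcontract]; ring
    _ = 2 * (of ![κ, P *ᵥ a, β]).det := by rw [hswap]; ring

lemma sum_cottonYorkCoeff_eq_det (hG : (G x).IsSymm)
    (hC : ∀ i j k, cotton G i j k x = κ i * P j k - κ j * P i k) (a b : Fin 3 → ℝ) :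
    ∑ i, ∑ j, cottonYorkCoeff G i j x * a i * b j
      = (of ![κ, P *ᵥ a, G x *ᵥ b]).det / √(G x).det := by
  calc ∑ i, ∑ j, cottonYorkCoeff G i j x * a i * b j
      = (1 / 2) * (∑ σ : Equiv.Perm (Fin 3), (∑ k, cotton G (σ 0) (σ 1) k x * a k)
        * (G x *ᵥ b) (σ 2) * ((Equiv.Perm.sign σ : ℤ) : ℝ)) / √(G x).det := by
        rw [← hG.eq, mulVec_transpose]
        simp only [cottonYorkCoeff, vecMul, dotProduct, Fin.sum_univ_three, Finset.mul_sum,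
          Finset.sum_mul, Finset.sum_div, ← Finset.sum_add_distrib, hG.eq]
        exact Finset.sum_congr rfl fun σ _ => by ring
    _ = (of ![κ, P *ᵥ a, G x *ᵥ b]).det / √(G x).det := by
        rw [sum_cotton_eq_det hC]
        ring

variable {V : Fin 3 → ℝ} {t : ℝ}

lemma sum_cottonYorkCoeff_self_eq_zero (hG : (G x).IsSymm)
    (hC : ∀ i j k, cotton G i j k x = κ i * P j k - κ j * P i k) (hPV : P *ᵥ V = t • G x *ᵥ V) :
    ∑ i, ∑ j, cottonYorkCoeff G i j x * V i * V j = 0 := by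
  have hdet : ∀ β : Fin 3 → ℝ, (of ![κ, t • β, β]).det = 0 := fun β => by
    simp only [det_fin_three, of_apply, cons_val, Pi.smul_apply, smul_eq_mul]
    ring
  rw [sum_cottonYorkCoeff_eq_det hG hC, hPV, hdet, zero_div]

lemma sum_cottonYorkCoeff_eq_zero_of_orthogonal (hG : (G x).IsSymm)
    (hC : ∀ i j k, cotton G i j k x = κ i * P j k - κ j * P i k) (hP : P.IsSymm)
    (hPV : P *ᵥ V = t • G x *ᵥ V) (hκ : V ⬝ᵥ κ = 0) (hV : V ≠ 0) {a b : Fin 3 → ℝ}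
    (ha : V ⬝ᵥ G x *ᵥ a = 0) (hb : V ⬝ᵥ G x *ᵥ b = 0) :
    ∑ i, ∑ j, cottonYorkCoeff G i j x * a i * b j = 0 := by
  have hPa : V ⬝ᵥ P *ᵥ a = 0 := by
    rw [dotProduct_mulVec, ← mulVec_transpose, hP.eq, hPV, smul_dotProduct, ← hG.eq,
      mulVec_transpose, ← dotProduct_mulVec, ha, smul_zero]
  have hker : of ![κ, P *ᵥ a, G x *ᵥ b] *ᵥ V = 0 := by
    ext i
    rw [mulVec, dotProduct_comm]
    fin_cases i
    exacts [hκ, hPa, hb]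
  rw [sum_cottonYorkCoeff_eq_det hG hC, exists_mulVec_eq_zero_iff.mp ⟨V, hV, hker⟩, zero_div]

end CottonYorkAlgebra

section Charts

variable {n : ℕ} {M : Type*} [TopologicalSpace M] [ChartedSpace (Model n) M]
  {e : OpenPartialHomeomorph M (Model n)} {x : Model n}

lemma mdifferentiable_of_mem_maximalAtlas
    (he : e ∈ IsManifold.maximalAtlas 𝓘(ℝ, Model n) ∞ M) :
    e.MDifferentiable 𝓘(ℝ, Model n) 𝓘(ℝ, Model n) :=
  ⟨(contMDiffOn_of_mem_maximalAtlas he).mdifferentiableOn (by simp),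
    (contMDiffOn_symm_of_mem_maximalAtlas he).mdifferentiableOn (by simp)⟩

lemma map_eq_sum_single {W : Type*} [NormedAddCommGroup W] [NormedSpace ℝ W]
    (L : Model n →L[ℝ] W) (a : Model n) :
    L a = ∑ i, a i • L (EuclideanSpace.single i 1) := by
  have h := congrArg L ((EuclideanSpace.basisFun (Fin n) ℝ).sum_repr a)
  simpa only [map_sum, map_smul, EuclideanSpace.basisFun_apply, EuclideanSpace.basisFun_repr]
    using h.symm

lemma fderiv_eq_zero_of_pd {F : Model n → ℝ} (h : ∀ i, pd i F x = 0) : fderiv ℝ F x = 0 := by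
  ext v
  rw [map_eq_sum_single]
  exact Finset.sum_eq_zero fun i _ => (congrArg _ (h i)).trans (smul_zero _)

lemma sum_coordOf_smul_coordVec (he : e ∈ IsManifold.maximalAtlas 𝓘(ℝ, Model n) ∞ M)
    (hx : x ∈ e.target) (v : TangentSpace 𝓘(ℝ, Model n) (e.symm x)) :
    ∑ i, coordOf e (e.symm x) v i • coordVec e x i = v := by
  have hinv := (mdifferentiable_of_mem_maximalAtlas he).symm_comp_deriv (e.map_target hx)
  rw [e.right_inv hx] at hinv
  exact (map_eq_sum_single (W := Model n) (mfderiv 𝓘(ℝ, Model n) 𝓘(ℝ, Model n) e.symm x)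
    (coordOf e (e.symm x) v)).symm.trans (congrArg (fun L => L v) hinv)

lemma exists_coordOf_eq (he : e ∈ IsManifold.maximalAtlas 𝓘(ℝ, Model n) ∞ M)
    (hx : x ∈ e.target) (a : Model n) :
    ∃ v : TangentSpace 𝓘(ℝ, Model n) (e.symm x), coordOf e (e.symm x) v = a :=
  ⟨mfderiv 𝓘(ℝ, Model n) 𝓘(ℝ, Model n) e.symm x a,
    congrArg (fun L => L a) ((mdifferentiable_of_mem_maximalAtlas he).comp_symm_deriv hx)⟩

variable [IsManifold 𝓘(ℝ, Model n) ∞ M]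

lemma contDiffOn_coordOf (he : e ∈ IsManifold.maximalAtlas 𝓘(ℝ, Model n) ∞ M)
    {X : ∀ p : M, TangentSpace 𝓘(ℝ, Model n) p}
    (hX : ContMDiff 𝓘(ℝ, Model n) 𝓘(ℝ, Model n).tangent ∞
      (fun p => (⟨p, X p⟩ : TangentBundle 𝓘(ℝ, Model n) M))) :
    ContDiffOn ℝ ∞ (fun y => coordOf e (e.symm y) (X (e.symm y))) e.target := by
  have htangentMap := (contMDiffOn_of_mem_maximalAtlas he).contMDiffOn_tangentMapWithin
    (m := ∞) (by simp) e.open_source.uniqueMDiffOn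
  have hcomp := (htangentMap.comp (hX.contMDiffOn (s := e.source)) fun x hx => hx).comp
    (contMDiffOn_symm_of_mem_maximalAtlas he) fun x hx => e.map_target hx
  have hsnd :=
    (contMDiff_snd_tangentBundle_modelSpace (Model n) 𝓘(ℝ, Model n)).comp_contMDiffOn hcomp
  refine (contMDiffOn_iff_contDiffOn.mp hsnd).congr fun x hx => ?_
  simp only [Function.comp, tangentMapWithin, coordOf]
  rw [mfderivWithin_of_isOpen e.open_source (e.map_target hx)]

lemma contMDiffOn_coordVec (he : e ∈ IsManifold.maximalAtlas 𝓘(ℝ, Model n) ∞ M) (i : Fin n) :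
    ContMDiffOn 𝓘(ℝ, Model n) 𝓘(ℝ, Model n).tangent ∞
      (fun x => (⟨e.symm x, coordVec e x i⟩ : TangentBundle 𝓘(ℝ, Model n) M)) e.target := by
  have htangentMap := (contMDiffOn_symm_of_mem_maximalAtlas he).contMDiffOn_tangentMapWithin
    (m := ∞) (by simp) e.open_target.uniqueMDiffOn
  have hconst : ContMDiffOn 𝓘(ℝ, Model n) 𝓘(ℝ, Model n).tangent ∞
      (fun x : Model n => (⟨x, (EuclideanSpace.single i (1 : ℝ) : Model n)⟩ :
        TangentBundle 𝓘(ℝ, Model n) (Model n))) e.target :=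
    contMDiffOn_vectorSpace_iff_contDiffOn.mpr contDiffOn_const
  refine (htangentMap.comp hconst fun x hx => hx).congr fun x hx => ?_
  simp only [Function.comp, tangentMapWithin, coordVec]
  rw [mfderivWithin_of_isOpen e.open_target hx]

lemma contDiffOn_metricMatrix (g : SmoothMetric n M)
    (he : e ∈ IsManifold.maximalAtlas 𝓘(ℝ, Model n) ∞ M) (i j : Fin n) :
    ContDiffOn ℝ ∞ (fun x => metricMatrix g e x i j) e.target := by
  rw [← contMDiffOn_iff_contDiffOn]
  intro x hx
  have hbase := contMDiffOn_symm_of_mem_maximalAtlas he x hx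
  have hsection : ContMDiffWithinAt 𝓘(ℝ, Model n) (𝓘(ℝ, Model n).prod 𝓘(ℝ)) ∞
      (fun y => Bundle.TotalSpace.mk' ℝ (E := Bundle.Trivial M ℝ) (e.symm y)
        (g.inner (e.symm y) (coordVec e y i) (coordVec e y j))) e.target x :=
    ContMDiffWithinAt.clm_bundle_apply₂ (F₁ := Model n) (F₂ := Model n)
      (g.contMDiff.contMDiffAt.comp_contMDiffWithinAt x hbase)
      (contMDiffOn_coordVec he i x hx) (contMDiffOn_coordVec he j x hx)
  exact ((Bundle.contMDiffWithinAt_totalSpace ..).mp hsection).2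

lemma metricMatrix_isSymm (g : SmoothMetric n M) (e : OpenPartialHomeomorph M (Model n))
    (x : Model n) : (metricMatrix g e x).IsSymm :=
  IsSymm.ext fun _ _ => g.symm _ _ _

lemma inner_eq_dotProduct (g : SmoothMetric n M)
    (he : e ∈ IsManifold.maximalAtlas 𝓘(ℝ, Model n) ∞ M) (hx : x ∈ e.target)
    (v w : TangentSpace 𝓘(ℝ, Model n) (e.symm x)) :
    g.inner (e.symm x) v w = (coordOf e (e.symm x) v).ofLp ⬝ᵥ
      metricMatrix g e x *ᵥ (coordOf e (e.symm x) w).ofLp := by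
  conv_lhs => rw [← sum_coordOf_smul_coordVec he hx v, ← sum_coordOf_smul_coordVec he hx w]
  simp only [map_sum, map_smul, _root_.sum_apply, _root_.smul_apply, smul_eq_mul, mulVec,
    dotProduct, Finset.mul_sum, metricMatrix, of_apply]
  rw [Finset.sum_comm]
  exact Finset.sum_congr rfl fun i _ => Finset.sum_congr rfl fun j _ => by ring

lemma det_metricMatrix_ne_zero (g : SmoothMetric n M)
    (he : e ∈ IsManifold.maximalAtlas 𝓘(ℝ, Model n) ∞ M) (hx : x ∈ e.target) :
    (metricMatrix g e x).det ≠ 0 := fun hdet => by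
  obtain ⟨a, ha, hker⟩ := exists_mulVec_eq_zero_iff.mpr hdet
  obtain ⟨v, hv⟩ := exists_coordOf_eq he hx (WithLp.toLp 2 a)
  have hv0 : v ≠ 0 := by
    rintro rfl
    exact ha (congrArg WithLp.ofLp (hv.symm.trans (map_zero _)))
  refine (g.pos _ v hv0).ne' ?_
  rw [inner_eq_dotProduct g he hx, hv, hker, dotProduct_zero]

lemma IsConformal.exists_metricMatrix_eq {g g' : SmoothMetric n M} (hconf : IsConformal g g')
    (he : e ∈ IsManifold.maximalAtlas 𝓘(ℝ, Model n) ∞ M) :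
    ∃ f : Model n → ℝ, ContDiffOn ℝ ∞ f e.target ∧
      ∀ x, metricMatrix g e x = Real.exp (2 * f x) • metricMatrix g' e x := by
  obtain ⟨f, hf, hfg⟩ := hconf
  refine ⟨fun x => -f (e.symm x), (contMDiffOn_iff_contDiffOn.mp
    (hf.comp_contMDiffOn (contMDiffOn_symm_of_mem_maximalAtlas he))).neg, fun x => ?_⟩
  ext i j
  simp only [metricMatrix, of_apply, Matrix.smul_apply, smul_eq_mul, hfg]
  rw [← mul_assoc, ← Real.exp_add, mul_neg, neg_add_cancel, Real.exp_zero, one_mul]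

end Charts

section ParallelFields

variable {n : ℕ} {M : Type*} [TopologicalSpace M] [ChartedSpace (Model n) M]
  [IsManifold 𝓘(ℝ, Model n) ∞ M] {g : SmoothMetric n M}
  {X : ∀ p : M, TangentSpace 𝓘(ℝ, Model n) p} {e : OpenPartialHomeomorph M (Model n)}

/-- The components of the vector field `X` in the chart `e`, as functions of the coordinates. -/
def coordField (e : OpenPartialHomeomorph M (Model n))
    (X : ∀ p : M, TangentSpace 𝓘(ℝ, Model n) p) (x : Model n) : Fin n → ℝ :=
  (coordOf e (e.symm x) (X (e.symm x))).ofLp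

lemma IsParallel.isParallelOn (hX : IsParallel g X)
    (he : e ∈ IsManifold.maximalAtlas 𝓘(ℝ, Model n) ∞ M) :
    IsParallelOn ⟨e.target, e.open_target⟩ (metricMatrix g e) (coordField e X) where
  contDiffOn_metric := contDiffOn_metricMatrix g he
  contDiffOn_field := contDiffOn_euclidean.mp (contDiffOn_coordOf he hX.1)
  isSymm x _ := metricMatrix_isSymm g e x
  det_ne_zero _ hx := det_metricMatrix_ne_zero g he hx
  parallel := hX.2 e he

lemma IsParallel.isLocallyConstant_normSq (hX : IsParallel g X) :
    IsLocallyConstant fun p => g.inner p (X p) (X p) := by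
  refine (IsLocallyConstant.iff_exists_open _).mpr fun p => ?_
  let e := chartAt (Model n) p
  have he : e ∈ IsManifold.maximalAtlas 𝓘(ℝ, Model n) ∞ M := IsManifold.chart_mem_maximalAtlas p
  have hp : p ∈ e.source := mem_chart_source _ p
  let F : Model n → ℝ := fun y => coordField e X y ⬝ᵥ metricMatrix g e y *ᵥ coordField e X y
  have hval : ∀ q ∈ e.source, g.inner q (X q) (X q) = F (e q) := fun q hq => by
    obtain ⟨y, hy, rfl⟩ : ∃ y ∈ e.target, e.symm y = q := ⟨e q, e.map_source hq, e.left_inv hq⟩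
    rw [e.right_inv hy]
    exact inner_eq_dotProduct g he hy _ _
  have hsmooth : ContDiffOn ℝ ∞ F e.target := by
    have hG := contDiffOn_metricMatrix g he
    have hV := (hX.isParallelOn he).contDiffOn_field
    simp only [F, dotProduct, mulVec]
    exact ContDiffOn.sum fun i _ => (hV i).mul (ContDiffOn.sum fun j _ => (hG i j).mul (hV j))
  have hderiv : e.target.EqOn (fderiv ℝ F) 0 := fun y hy =>
    fderiv_eq_zero_of_pd fun i => (hX.isParallelOn he).pd_normSq i ⟨y, hy⟩
  refine ⟨e.source ∩ e ⁻¹' (e.target ∩ F ⁻¹' {F (e p)}), e.isOpen_inter_preimage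
    (e.open_target.isOpen_inter_preimage_of_fderiv_eq_zero (hsmooth.differentiableOn (by simp))
      hderiv _), ⟨hp, e.map_source hp, rfl⟩, fun q hq => ?_⟩
  rw [hval q hq.1, hval p hp]
  exact hq.2.2

lemma IsParallel.ne_zero (hX : IsParallel g X)
    (hX0 : ∀ p : M, ∃ q ∈ connectedComponent p, X q ≠ 0) (p : M) : X p ≠ 0 := fun hp => by
  obtain ⟨q, hq, hXq⟩ := hX0 p
  have hconst : g.inner p (X p) (X p) = g.inner q (X q) (X q) :=
    hX.isLocallyConstant_normSq.apply_eq_of_isPreconnected isPreconnected_connectedComponent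
      mem_connectedComponent hq
  refine (g.pos q (X q) hXq).ne' ?_
  rw [← hconst, hp, map_zero]

lemma IsParallel.coordField_normSq_ne_zero (hX : IsParallel g X)
    (hX0 : ∀ p : M, ∃ q ∈ connectedComponent p, X q ≠ 0)
    (he : e ∈ IsManifold.maximalAtlas 𝓘(ℝ, Model n) ∞ M) {x : Model n} (hx : x ∈ e.target) :
    coordField e X x ⬝ᵥ metricMatrix g e x *ᵥ coordField e X x ≠ 0 := by
  rw [coordField, ← inner_eq_dotProduct g he hx]
  exact (g.pos _ _ (hX.ne_zero hX0 _)).ne'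

end ParallelFields

end ConformalGeom

end

open scoped Manifold ContDiff in
open ConformalGeom in
theorem theorem1p5 {M : Type*} [TopologicalSpace M] [ChartedSpace (Model 3) M]
    [IsManifold 𝓘(ℝ, Model 3) ∞ M] (g g' : SmoothMetric 3 M) (hconf : IsConformal g g')
    (X : ∀ p : M, TangentSpace 𝓘(ℝ, Model 3) p) (hX : IsParallel g' X)
    (hX0 : ∀ p : M, ∃ q ∈ connectedComponent p, X q ≠ 0) (p : M) :
    ∃ v : TangentSpace 𝓘(ℝ, Model 3) p, v ≠ 0 ∧
      ∀ e ∈ IsManifold.maximalAtlas 𝓘(ℝ, Model 3) ∞ M, p ∈ e.source →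
        cottonYork g e p v v = 0 ∧
        ∀ w₁ w₂ : TangentSpace 𝓘(ℝ, Model 3) p,
          g.inner p v w₁ = 0 → g.inner p v w₂ = 0 → cottonYork g e p w₁ w₂ = 0 := by
  refine ⟨X p, hX.ne_zero hX0 p, fun e he hp => ?_⟩
  obtain ⟨x, hx, rfl⟩ : ∃ x ∈ e.target, e.symm x = p := ⟨e p, e.map_source hp, e.left_inv hp⟩
  obtain ⟨f, hf, hfg⟩ := hconf.exists_metricMatrix_eq he
  have hnormSq := fun y hy => hX.coordField_normSq_ne_zero hX0 he (x := y) hy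
  have hfield : coordField e X x ≠ 0 := fun h => hnormSq x hx (by rw [h, zero_dotProduct])
  have hsymm := metricMatrix_isSymm g e x
  obtain ⟨κ, P, t, hκ, hP, hPV, hC⟩ := (hX.isParallelOn he).exists_cotton_eq_of_conformal
    hnormSq hf (fun y _ => hfg y) ⟨x, hx⟩
  simp only [cottonYork, e.right_inv hx, inner_eq_dotProduct g he hx]
  exact ⟨sum_cottonYorkCoeff_self_eq_zero hsymm hC hPV, fun _ _ hw₁ hw₂ =>
    sum_cottonYorkCoeff_eq_zero_of_orthogonal hsymm hC hP hPV hκ hfield hw₁ hw₂⟩
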